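/- **Setting.** The pure second-order language $L_0$ has only variables, for objects and for relations of every arity $\ge 1$ (unary ones are called concepts), and no non-logical symbols. Models are Henkin (non-standard) structures $\mathcal M=(M,S_1[M],S_2[M],\dots)$ with $M\neq\emptyset$ and $S_i[M]\subseteq\mathcal P(M^i)$; second-order quantifiers of arity $i$ range over $S_i[M]$. A *background model*, in a language extending $L_0$ by non-logical symbols, is such a structure which satisfies comprehension with parameters for all formulas of its language, and whose cardinalities are well behaved, where all comparisons are by injections and bijections that belong to $\mathcal M$ and $|X|\ge\omega$ means Dedekind infinite in $\mathcal M$: - for all concepts $X,Y$: $|X|\le|Y|$ or $|Y|\le|X|$; - if $|X|,|Y|\ge\omega$ then $|X\sqcup Y|=\max(|X|,|Y|)$ and $|X\times Y|=\max(|X|,|Y|)$; - for every $L_0$-formula $\Phi(X)$ (parameters allowed), if some concept satisfies $\Phi$, then some concept satisfying $\Phi$ has least cardinality among those that do. For a relation $E$ between concepts, $A_E$ is the theory consisting of the background theory, with comprehension for all formulas of the language including the new symbol $\partial$ (a function from concepts to objects), and the abstraction principle $\forall X,Y\,(\partial X=\partial Y\leftrightarrow E(X,Y))$. It is consistent if it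 has a model. In a background model, concepts $X,Y$ are bicardinally equivalent, $X\boxminus Y$, if $|X|=|Y|$ and $|M-X|=|M-Y|$. A concept $X$ is exponentially large if there is no $R\in S_2[M]$ such that every concept $U\subseteq X$ is of the form $R[x]=\{y: R(x,y)\}$ for some object $x$; $X$ is TOP if $X$ and $M-X$ are both exponentially large. The basal relation is $$E_0(X,Y):\iff \bigl(X,Y\text{ are TOP and } X\boxminus Y\bigr)\ \text{ or }\ \bigl(\text{neither } X \text{ nor } Y\text{ is TOP, and } X=Y\bigr).$$ **Theorem (Generalization of Fine's Characterization Theorem).** 1. $A_{E_0}$ is consistent. 2. Let $E(X,Y)$ be expressible, i.e. defined by a formula of $L_0$ or of an extension of $L_0$ by non-logical symbols, with only the concept variables $X,Y$ free. Suppose that in every background model $\mathcal M$ of its language $E$ is an equivalence relation on concepts and is permutation invariant: $E(X,Y)\leftrightarrow E(\pi(X),\pi(Y))$ for every bijection $\pi:M\to M$ belonging to $\mathcal M$. Then $A_E\models\forall X,Y\,(E_0(X,Y)\to E(X,Y))$; that is, if $A_E$ is consistent, then $E_0$ is finer than $E$ in every model of $A_E$. -/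

import Mathlib

universe u v

namespace SOL

/-! ### Languages and formulas of second-order logic

Second-order variables come in sorts `n : ℕ`; sort `n` is the sort of relations of arity `n + 1`, so
sort `0` is the sort of concepts.  Variables of every kind are named by natural numbers. -/

/-- The non-logical vocabulary added to the pure second-order language `L₀`: predicate symbols taking
`objArity s` objects and `relNum s` relations, the `i`-th of them of sort `relSort s i`.
(Individual constants, relation constants and functors are covered through their graphs.) -/
structure Signature where
  Symb : Type v
  objArity : Symb → ℕ
  relNum : Symb → ℕ
  relSort : (s : Symb) → Fin (relNum s) → ℕ

/-- The pure second-order language `L₀`: no non-logical vocabulary. -/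
def Signature.pure : Signature.{0} where
  Symb := Empty
  objArity := fun s => s.elim
  relNum := fun s => s.elim
  relSort := fun s => s.elim

/-- The language `L[∂]`: one further symbol `none`, read `x = ∂ X` (one object, one concept). -/
def Signature.withAbs (L : Signature.{v}) : Signature.{v} where
  Symb := Option L.Symb
  objArity
    | none => 1
    | some s => L.objArity s
  relNum
    | none => 1
    | some s => L.relNum s
  relSort
    | none => fun _ => 0
    | some s => L.relSort s

/-- Second-order formulas in the vocabulary `L`. -/
inductive Formula (L : Signature.{v}) : Type v
  /-- `x = y` -/
  | eq (x y : ℕ) : Formula L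
  /-- `X x₀ … xₙ`, where `X` is a second-order variable of sort `n` -/
  | app (n X : ℕ) (x : Fin (n + 1) → ℕ) : Formula L
  /-- a non-logical symbol applied to object variables and relation variables -/
  | symb (s : L.Symb) (x : Fin (L.objArity s) → ℕ) (X : Fin (L.relNum s) → ℕ) : Formula L
  | neg (φ : Formula L) : Formula L
  | and (φ ψ : Formula L) : Formula L
  /-- `∀ x, φ` over objects -/
  | allObj (x : ℕ) (φ : Formula L) : Formula L
  /-- `∀ X, φ` over relations of sort `n` -/
  | allRel (n X : ℕ) (φ : Formula L) : Formula L

/-! ### Non-standard (Henkin) structures -/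

/-- `(M, S₁[M], S₂[M], …)`, with `Rel n = S_{n+1}[M]` a set of subsets of `M^(n+1)`. -/
structure Frame where
  carrier : Type u
  nonempty : Nonempty carrier
  Rel : (n : ℕ) → Set (Set (Fin (n + 1) → carrier))
  rel_nonempty : ∀ n, (Rel n).Nonempty

/-- A frame with an interpretation of the non-logical symbols of `L`.  (Only the values of `interp`
on relations belonging to the frame matter.) -/
structure Structure (L : Signature.{v}) extends Frame.{u} where
  interp : (s : L.Symb) → (Fin (L.objArity s) → carrier) →
    ((i : Fin (L.relNum s)) → Set (Fin (L.relSort s i + 1) → carrier)) → Prop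

/-- A frame seen as a structure for the pure language `L₀`. -/
def Frame.toPure (M : Frame.{u}) : Structure.{u, 0} Signature.pure where
  toFrame := M
  interp := fun s => s.elim

/-- The expansion `(N, ∂)` of an `L`-structure.  (Only the values of `d` on concepts matter.) -/
def Structure.expand {L : Signature.{v}} (N : Structure.{u, v} L)
    (d : Set N.carrier → N.carrier) : Structure.{u, v} L.withAbs where
  toFrame := N.toFrame
  interp
    | none => fun x X => x (0 : Fin 1) = d {m | (fun _ => m) ∈ X (0 : Fin 1)}
    | some s => N.interp s

/-- Assignments to the object variables, and to the second-order variables of each sort. -/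
abbrev Frame.ObjAssign (M : Frame.{u}) : Type u := ℕ → M.carrier
abbrev Frame.RelAssign (M : Frame.{u}) : Type u := (n : ℕ) → ℕ → Set (Fin (n + 1) → M.carrier)

/-- The second-order variables take values in the relations of the frame. -/
def Frame.Admissible (M : Frame.{u}) (A : M.RelAssign) : Prop := ∀ n i, A n i ∈ M.Rel n

/-- The assignment `A[X := R]`, where `X` is a second-order variable of sort `n`. -/
def Frame.setRel (M : Frame.{u}) (A : M.RelAssign) (n X : ℕ) (R : Set (Fin (n + 1) → M.carrier)) :
    M.RelAssign :=
  Function.update A n (Function.update (A n) X R)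

/-- Satisfaction; second-order quantifiers range over the relations of the structure. -/
def Structure.Sat {L : Signature.{v}} (N : Structure.{u, v} L) :
    Formula L → N.ObjAssign → N.RelAssign → Prop
  | .eq x y, a, _ => a x = a y
  | .app n X x, a, A => (fun i => a (x i)) ∈ A n X
  | .symb s x X, a, A => N.interp s (fun i => a (x i)) (fun i => A (L.relSort s i) (X i))
  | .neg φ, a, A => ¬ N.Sat φ a A
  | .and φ ψ, a, A => N.Sat φ a A ∧ N.Sat ψ a A
  | .allObj x φ, a, A => ∀ m : N.carrier, N.Sat φ (Function.update a x m) A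
  | .allRel n X φ, a, A => ∀ R ∈ N.Rel n, N.Sat φ a (N.setRel A n X R)

/-- Full comprehension for all formulas of the signature, with object and relation parameters;
the object variables `0, …, n` are those being comprehended. -/
def Structure.Comprehension {L : Signature.{v}} (N : Structure.{u, v} L) : Prop :=
  ∀ (n : ℕ) (φ : Formula L) (a : N.ObjAssign) (A : N.RelAssign), N.Admissible A →
    {y : Fin (n + 1) → N.carrier |
      N.Sat φ (fun i => if h : i < n + 1 then y ⟨i, h⟩ else a i) A} ∈ N.Rel n

/-! ### Cardinality notions internal to a frame -/

namespace Frame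

variable (M : Frame.{u})

/-- A set of objects as a unary relation. -/
def asRel (X : Set M.carrier) : Set (Fin 1 → M.carrier) := {y | y 0 ∈ X}

/-- `X` is a concept of `M`, i.e. a member of `S₁[M]`. -/
def IsConcept (X : Set M.carrier) : Prop := M.asRel X ∈ M.Rel 0

/-- The restriction of `f` to `X` belongs to `M` (its graph is a member of `S₂[M]`). -/
def HasFun (f : M.carrier → M.carrier) (X : Set M.carrier) : Prop :=
  {y : Fin 2 → M.carrier | y 0 ∈ X ∧ y 1 = f (y 0)} ∈ M.Rel 1

/-- `M ⊨ |X| ≤ |Y|`: an injection of `X` into `Y` belongs to `M`. -/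
def CardLe (X Y : Set M.carrier) : Prop :=
  ∃ f : M.carrier → M.carrier, M.HasFun f X ∧ Set.MapsTo f X Y ∧ Set.InjOn f X

/-- `M ⊨ |X| = |Y|`: a bijection of `X` onto `Y` belongs to `M`. -/
def CardEq (X Y : Set M.carrier) : Prop :=
  ∃ f : M.carrier → M.carrier, M.HasFun f X ∧ Set.BijOn f X Y

/-- `M ⊨ X ⊟ Y`: bicardinal equivalence. -/
def Bicard (X Y : Set M.carrier) : Prop := M.CardEq X Y ∧ M.CardEq Xᶜ Yᶜ

/-- `M ⊨ |X| ≥ ω`: `X` is Dedekind infinite in `M`. -/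
def Infinite (X : Set M.carrier) : Prop :=
  ∃ Z, M.IsConcept Z ∧ Z ⊂ X ∧ M.CardLe X Z

/-- `M ⊨ |X ⊔ Y| = |Z|`: a bijection of the disjoint union onto `Z`, given by its two halves. -/
def SumEq (X Y Z : Set M.carrier) : Prop :=
  ∃ f g : M.carrier → M.carrier, M.HasFun f X ∧ M.HasFun g Y ∧ Set.InjOn f X ∧ Set.InjOn g Y ∧
    Disjoint (f '' X) (g '' Y) ∧ f '' X ∪ g '' Y = Z

/-- `M ⊨ |X × Y| = |Z|`: a bijection of the product onto `Z`, with graph in `S₃[M]`. -/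
def ProdEq (X Y Z : Set M.carrier) : Prop :=
  ∃ h : M.carrier × M.carrier → M.carrier,
    {y : Fin 3 → M.carrier | y 0 ∈ X ∧ y 1 ∈ Y ∧ y 2 = h (y 0, y 1)} ∈ M.Rel 2 ∧
    Set.BijOn h (X ×ˢ Y) Z

/-- Cardinal comparability. -/
def CardinalComparability : Prop :=
  ∀ X Y, M.IsConcept X → M.IsConcept Y → M.CardLe X Y ∨ M.CardLe Y X

/-- Infinite sums are maxima: `|X ⊔ Y| = max(|X|, |Y|)` for infinite `X`, `Y`. -/
def InfiniteSumsAreMaxima : Prop :=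
  ∀ X Y, M.IsConcept X → M.IsConcept Y → M.Infinite X → M.Infinite Y →
    (M.CardLe X Y → M.SumEq X Y Y) ∧ (M.CardLe Y X → M.SumEq X Y X)

/-- Infinite products are maxima: `|X × Y| = max(|X|, |Y|)` for infinite `X`, `Y`. -/
def InfiniteProductsAreMaxima : Prop :=
  ∀ X Y, M.IsConcept X → M.IsConcept Y → M.Infinite X → M.Infinite Y →
    (M.CardLe X Y → M.ProdEq X Y Y) ∧ (M.CardLe Y X → M.ProdEq X Y X)

/-- `M ⊨ Φ(X)`, where the concept variable `0` of `Φ` stands for `X` and the other variables get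
their values (parameters) from `a` and `A`. -/
def SatAt (Φ : Formula Signature.pure) (a : M.ObjAssign) (A : M.RelAssign) (X : Set M.carrier) :
    Prop :=
  M.toPure.Sat Φ a (M.setRel A 0 0 (M.asRel X))

/-- Cardinal well-foundedness: if some concept satisfies the `L₀`-formula `Φ`, then some concept
satisfying `Φ` has least cardinality among those that do. -/
def CardinalsWellFounded : Prop :=
  ∀ (Φ : Formula Signature.pure) (a : M.ObjAssign) (A : M.RelAssign), M.Admissible A →
    (∃ X, M.IsConcept X ∧ M.SatAt Φ a A X) →
    ∃ X, M.IsConcept X ∧ M.SatAt Φ a A X ∧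
      ∀ Y, M.IsConcept Y → M.SatAt Φ a A Y → M.CardLe X Y

/-- The cardinalities of `M` are well behaved. -/
structure WellBehaved : Prop where
  comparability : M.CardinalComparability
  sums : M.InfiniteSumsAreMaxima
  products : M.InfiniteProductsAreMaxima
  wellFounded : M.CardinalsWellFounded

/-! ### The basal equivalence relation -/

/-- `R[x] = {y | R(x, y)}`. -/
def section_ (R : Set (Fin 2 → M.carrier)) (x : M.carrier) : Set M.carrier := {y | ![x, y] ∈ R}

/-- `R` "injects" the `E`-classes of subconcepts of `W` into the objects:
`|(S₁[M] ↾ W) / E| ≤ |M|` via `R`. -/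
def ClassesInject (E : Set M.carrier → Set M.carrier → Prop) (W : Set M.carrier)
    (R : Set (Fin 2 → M.carrier)) : Prop :=
  (∀ U, M.IsConcept U → U ⊆ W → ∃ x, M.section_ R x ⊆ U ∧ E (M.section_ R x) U) ∧
  ∀ x y, ¬ E (M.section_ R x) (M.section_ R y) → x ≠ y

/-- `EXPL(X)`: the subconcepts of `X` outnumber the objects. -/
def Expl (X : Set M.carrier) : Prop :=
  ¬ ∃ R ∈ M.Rel 1, M.ClassesInject (fun U V => U = V) X R

/-- `TOP(X)`: `X` and its complement are both exponentially large. -/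
def Top (X : Set M.carrier) : Prop := M.Expl X ∧ M.Expl Xᶜ

/-- The basal relation `E₀`. -/
def Basal (X Y : Set M.carrier) : Prop :=
  (M.Top X ∧ M.Top Y ∧ M.Bicard X Y) ∨ (¬ (M.Top X ∨ M.Top Y) ∧ X = Y)

/-! ### Relations on the concepts of a frame -/

/-- `E` is an equivalence relation on the concepts of `M`. -/
structure IsEquivOnConcepts (E : Set M.carrier → Set M.carrier → Prop) : Prop where
  refl : ∀ X, M.IsConcept X → E X X
  symm : ∀ X Y, M.IsConcept X → M.IsConcept Y → E X Y → E Y X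
  trans : ∀ X Y Z, M.IsConcept X → M.IsConcept Y → M.IsConcept Z → E X Y → E Y Z → E X Z

/-- `E` is invariant under the permutations of the objects that belong to `M`. -/
def PermInvariant (E : Set M.carrier → Set M.carrier → Prop) : Prop :=
  ∀ π : Equiv.Perm M.carrier, M.HasFun π Set.univ →
    ∀ X Y, M.IsConcept X → M.IsConcept Y → (E X Y ↔ E (π '' X) (π '' Y))

end Frame

namespace Structure

variable {L : Signature.{v}} (N : Structure.{u, v} L)

/-- The relation `E(X, Y)` on concepts expressed in `N` by the formula `φ`, whose concept variables
`0` and `1` stand for `X` and `Y`; any other free variables are read as universally quantified. -/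
def Rel2 (φ : Formula L) (X Y : Set N.carrier) : Prop :=
  ∀ (a : N.ObjAssign) (A : N.RelAssign), N.Admissible A →
    A 0 0 = N.asRel X → A 0 1 = N.asRel Y → N.Sat φ a A

/-- `N` is a model of the background logic: full comprehension in its signature and well-behaved
cardinalities. -/
def IsBackgroundModel : Prop := N.Comprehension ∧ N.toFrame.WellBehaved

/-- `(N, ∂) ⊨ A_E`: the expansion `(N, d)` satisfies the background logic (with comprehension for all
formulas of the language expanded by `∂`) and `∀ X Y, ∂X = ∂Y ↔ E(X, Y)`. -/
def ModelsAbstraction (d : Set N.carrier → N.carrier)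
    (E : Set N.carrier → Set N.carrier → Prop) : Prop :=
  (N.expand d).IsBackgroundModel ∧
    ∀ X Y, N.IsConcept X → N.IsConcept Y → (d X = d Y ↔ E X Y)

end Structure

end SOL

/-!
The two halves of the theorem are independent.

**Consistency.**  In the full second-order structure over `ℕ` a set is exponentially large just in
case it is infinite, by diagonalization (`fullNat.expl_iff`).  So the TOP concepts are the infinite,
coinfinite sets.  They are all bicardinally equivalent, and the remaining concepts are the countably
many finite and cofinite sets.  Hence `E₀` has countably many classes, which can be mapped injectively
into `ℕ` (`fullNat.exists_modelsAbstraction`).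

**`E₀` is finer than `E`.**  Let `(N, d)` be a model of `A_E`, let `X` be TOP and let `Y` be
bicardinally equivalent to `X`.  Since `d` takes equal values exactly at equivalent concepts, `E` is
definable from `d`; this and the permutation invariance of `E` are all that is used about `E`.

*The objects are infinite in `N`.*  Replacing `E(A, B)` by `E(M - A, M - B)` if necessary, let
`|X| ≤ |M - X|`.  Exponentially large concepts are infinite (`infinite_of_expl`), by well-foundedness
and because the union of two concepts that are not exponentially large is not so either.  Call a pair
of concepts generic if the cells of its Venn diagram are as large as possible.  All generic pairs are
conjugate under permutations, so `E` holds of all or of none (`rel_iff_of_generic`).  If of none,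
then a product decomposition of `X` yields a definable family of concepts, indexed by the subconcepts
of `X` and any two of which form a generic pair; its abstracts code the subconcepts of `X` by
objects, and `X` is not exponentially large (`not_expl_of_generic`).  If of all, then `X` and `Y` are
connected by a chain of generic pairs (`rel_of_generic`).

*The objects are Dedekind finite in `N`.*  If some exchange of one element for another leads to an
equivalent concept, then all exchanges do by invariance, and `X` is transformed into `Y` by exchanges.
The induction this needs concerns a predicate that involves `d`, whereas well-foundedness is available
for `L₀`-formulas only; it is used to find a chain that enumerates `X - Y` one element at a time, and
comprehension does the rest (`exists_isChain`, `rel_of_swap`).  If no exchange leads to an equivalent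
concept, then there are at least as many abstracts of results of exchanges as there are objects, not
counting the abstract of `X` itself, which contradicts finiteness (`infinite_of_not_swap`).

Comprehension is applied through the predicate `Structure.Dfn` of definability with parameters, which
is closed under the logical operations.
-/

namespace SOL

/-! ### Renaming variables and changing the vocabulary -/

/-- Rename all variables, bound ones included: object variables by `ρ`, second-order variables of
every sort by `σ`. -/
def Formula.rename {L : Signature.{v}} (ρ σ : ℕ → ℕ) : Formula L → Formula L
  | .eq x y => .eq (ρ x) (ρ y)
  | .app n X x => .app n (σ X) (fun i => ρ (x i))
  | .symb s x X => .symb s (fun i => ρ (x i)) (fun i => σ (X i))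
  | .neg φ => .neg (φ.rename ρ σ)
  | .and φ ψ => .and (φ.rename ρ σ) (ψ.rename ρ σ)
  | .allObj x φ => .allObj (ρ x) (φ.rename ρ σ)
  | .allRel n X φ => .allRel n (σ X) (φ.rename ρ σ)

/-- The sequence `a 0, b 0, a 1, b 1, …`. -/
def interleave {α : Type*} (a b : ℕ → α) (i : ℕ) : α := if i % 2 = 0 then a (i / 2) else b (i / 2)

namespace Frame

variable {M : Frame.{u}}

theorem setRel_self (A : M.RelAssign) (n X : ℕ) (R : Set (Fin (n + 1) → M.carrier)) :
    M.setRel A n X R n X = R := by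
  simp [setRel]

theorem setRel_of_index_ne (A : M.RelAssign) {n X Y : ℕ} (R : Set (Fin (n + 1) → M.carrier))
    (h : Y ≠ X) : M.setRel A n X R n Y = A n Y := by
  simp [setRel, h]

theorem setRel_of_sort_ne (A : M.RelAssign) {n k X : ℕ} (R : Set (Fin (n + 1) → M.carrier))
    (Y : ℕ) (h : k ≠ n) : M.setRel A n X R k Y = A k Y := by
  simp [setRel, h]

theorem Admissible.setRel {A : M.RelAssign} (hA : M.Admissible A) {n : ℕ} (X : ℕ)
    {R : Set (Fin (n + 1) → M.carrier)} (hR : R ∈ M.Rel n) : M.Admissible (M.setRel A n X R) := by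
  intro k i
  by_cases hk : k = n
  · subst hk
    by_cases hi : i = X
    · subst hi; rwa [setRel_self]
    · rw [setRel_of_index_ne _ _ hi]; exact hA _ _
  · rw [setRel_of_sort_ne _ _ _ hk]; exact hA _ _

theorem Admissible.interleave {A B : M.RelAssign} (hA : M.Admissible A) (hB : M.Admissible B) :
    M.Admissible (fun n => SOL.interleave (A n) (B n)) := by
  intro n i
  dsimp only [SOL.interleave]
  split_ifs
  · exact hA _ _
  · exact hB _ _

theorem exists_admissible (M : Frame.{u}) : ∃ A : M.RelAssign, M.Admissible A :=
  ⟨fun n _ => (M.rel_nonempty n).some, fun n _ => (M.rel_nonempty n).some_mem⟩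

end Frame

namespace Structure

theorem sat_rename {L : Signature.{v}} (N : Structure.{u, v} L) {ρ σ : ℕ → ℕ}
    (hρ : ρ.Injective) (hσ : σ.Injective) (φ : Formula L) :
    ∀ (a : N.ObjAssign) (A : N.RelAssign),
      N.Sat (φ.rename ρ σ) a A ↔ N.Sat φ (fun i => a (ρ i)) (fun n i => A n (σ i)) := by
  induction φ with
  | eq x y => intro a A; rfl
  | app n X x => intro a A; rfl
  | symb s x X => intro a A; rfl
  | neg φ ih => intro a A; exact not_congr (ih a A)
  | and φ ψ ih₁ ih₂ => intro a A; exact and_congr (ih₁ a A) (ih₂ a A)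
  | allObj x φ ih =>
    intro a A
    refine forall_congr' fun m => ?_
    rw [ih]
    have : (fun i => Function.update a (ρ x) m (ρ i)) =
        Function.update (fun i => a (ρ i)) x m := by
      funext i
      by_cases hi : i = x
      · subst hi; simp
      · simp [hi, hρ.ne hi]
    rw [this]
  | allRel n X φ ih =>
    intro a A
    refine forall₂_congr fun R _ => ?_
    rw [ih]
    have : (fun k i => N.setRel A n (σ X) R k (σ i)) =
        N.setRel (fun k i => A k (σ i)) n X R := by
      funext k i
      by_cases hk : k = n
      · subst hk
        by_cases hi : i = X
        · subst hi; simp [Frame.setRel_self]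
        · simp [Frame.setRel_of_index_ne, hi, hσ.ne hi]
      · simp [Frame.setRel_of_sort_ne, hk]
    rw [this]

end Structure

/-- An `L`-formula as a formula of `L[∂]`. -/
def Formula.toAbs {L : Signature.{v}} : Formula L → Formula L.withAbs
  | .eq x y => .eq x y
  | .app n X x => .app n X x
  | .symb s x X => .symb (L := L.withAbs) (some s) x X
  | .neg φ => .neg φ.toAbs
  | .and φ ψ => .and φ.toAbs ψ.toAbs
  | .allObj x φ => .allObj x φ.toAbs
  | .allRel n X φ => .allRel n X φ.toAbs

theorem Structure.sat_toAbs {L : Signature.{v}} (N : Structure.{u, v} L)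
    (d : Set N.carrier → N.carrier) (φ : Formula L) :
    ∀ (a : N.ObjAssign) (A : N.RelAssign), (N.expand d).Sat φ.toAbs a A ↔ N.Sat φ a A := by
  induction φ with
  | eq x y => intro a A; rfl
  | app n X x => intro a A; rfl
  | symb s x X => intro a A; rfl
  | neg φ ih => intro a A; exact not_congr (ih a A)
  | and φ ψ ih₁ ih₂ => intro a A; exact and_congr (ih₁ a A) (ih₂ a A)
  | allObj x φ ih => intro a A; exact forall_congr' fun m => ih _ _
  | allRel n X φ ih => intro a A; exact forall₂_congr fun R _ => ih _ _

/-- A reduct of a background model is a background model. -/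
theorem Structure.isBackgroundModel_of_expand {L : Signature.{v}} (N : Structure.{u, v} L)
    (d : Set N.carrier → N.carrier) (h : (N.expand d).IsBackgroundModel) :
    N.IsBackgroundModel := by
  refine ⟨fun n φ a A hA => ?_, h.2⟩
  exact (congrArg (· ∈ N.Rel n) (Set.ext fun y => N.sat_toAbs d φ _ A)).mp
    (h.1 n φ.toAbs a A hA)

/-! ### Definable predicates -/

theorem interleave_even {α : Type*} (a b : ℕ → α) (i : ℕ) : interleave a b (2 * i) = a i := by
  simp [interleave]

theorem interleave_odd {α : Type*} (a b : ℕ → α) (i : ℕ) : interleave a b (2 * i + 1) = b i := by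
  have h1 : (2 * i + 1) % 2 = 1 := by omega
  have h2 : (2 * i + 1) / 2 = i := by omega
  simp [interleave, h1, h2]

theorem update_interleave {α : Type*} (a b : ℕ → α) (k : ℕ) (m : α) :
    Function.update (interleave a b) (2 * k) m = interleave (Function.update a k m) b := by
  funext i
  rcases Nat.even_or_odd' i with ⟨j, rfl | rfl⟩
  · rw [interleave_even]
    by_cases h : j = k
    · subst h; simp
    · simp [h, interleave_even]
  · have : 2 * j + 1 ≠ 2 * k := by omega
    simp [this, interleave_odd]

/-- Keeps the even numbers fixed and spreads the odd ones. -/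
def spread (e : ℕ) (i : ℕ) : ℕ := if i % 2 = 0 then i else 2 * (2 * (i / 2) + e) + 1

theorem spread_injective (e : ℕ) : (spread e).Injective := by
  intro i j h
  unfold spread at h
  split_ifs at h <;> omega

theorem interleave_spread_zero {α : Type*} (a b c : ℕ → α) (i : ℕ) :
    interleave a (interleave b c) (spread 0 i) = interleave a b i := by
  rcases Nat.even_or_odd' i with ⟨j, rfl | rfl⟩
  · have : spread 0 (2 * j) = 2 * j := by simp [spread]
    simp only [this, interleave_even]
  · have : spread 0 (2 * j + 1) = 2 * (2 * j) + 1 := by unfold spread; split_ifs <;> omega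
    simp only [this, interleave_even, interleave_odd]

theorem interleave_spread_one {α : Type*} (a b c : ℕ → α) (i : ℕ) :
    interleave a (interleave b c) (spread 1 i) = interleave a c i := by
  rcases Nat.even_or_odd' i with ⟨j, rfl | rfl⟩
  · have : spread 1 (2 * j) = 2 * j := by simp [spread]
    simp only [this, interleave_even]
  · have : spread 1 (2 * j + 1) = 2 * (2 * j + 1) + 1 := by unfold spread; split_ifs <;> omega
    simp only [this, interleave_odd]

/-- The set of objects that belong to a unary relation; inverse to `Frame.asRel`. -/
def Frame.ofRel {M : Frame.{u}} (S : Set (Fin 1 → M.carrier)) : Set M.carrier :=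
  {m | (fun _ => m) ∈ S}

namespace Frame

variable {M : Frame.{u}}

theorem ofRel_asRel (X : Set M.carrier) : ofRel (M.asRel X) = X := rfl

theorem asRel_ofRel (S : Set (Fin 1 → M.carrier)) : M.asRel (ofRel S) = S := by
  ext y
  have : (fun _ => y 0) = y := by
    funext i; rw [Subsingleton.elim i 0]
  show (fun _ => y 0) ∈ S ↔ y ∈ S
  rw [this]

theorem isConcept_ofRel {S : Set (Fin 1 → M.carrier)} (h : S ∈ M.Rel 0) :
    M.IsConcept (ofRel S) := by
  unfold IsConcept; rwa [asRel_ofRel]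

end Frame

namespace Structure

variable {L : Signature.{v}} {N : Structure.{u, v} L}

/-- A predicate of assignments is definable with parameters in `N`.  In the defining formula the
`i`-th variable of each kind is named `2 * i`; the odd names are left for the parameters, so that
formulas with different parameters can be combined. -/
def Dfn (N : Structure.{u, v} L) (P : N.ObjAssign → N.RelAssign → Prop) : Prop :=
  ∃ (φ : Formula L) (b : N.ObjAssign) (B : N.RelAssign), N.Admissible B ∧
    ∀ a A, N.Admissible A →
      (N.Sat φ (interleave a b) (fun n => interleave (A n) (B n)) ↔ P a A)

namespace Dfn

theorem congr {P Q : N.ObjAssign → N.RelAssign → Prop} (h : N.Dfn P)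
    (e : ∀ a A, N.Admissible A → (Q a A ↔ P a A)) : N.Dfn Q := by
  obtain ⟨φ, b, B, hB, hφ⟩ := h
  exact ⟨φ, b, B, hB, fun a A hA => (hφ a A hA).trans (e a A hA).symm⟩

theorem not {P : N.ObjAssign → N.RelAssign → Prop} (h : N.Dfn P) :
    N.Dfn (fun a A => ¬ P a A) := by
  obtain ⟨φ, b, B, hB, hφ⟩ := h
  exact ⟨.neg φ, b, B, hB, fun a A hA => not_congr (hφ a A hA)⟩

theorem and {P Q : N.ObjAssign → N.RelAssign → Prop} (hP : N.Dfn P) (hQ : N.Dfn Q) :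
    N.Dfn (fun a A => P a A ∧ Q a A) := by
  obtain ⟨φ, b, B, hB, hφ⟩ := hP
  obtain ⟨ψ, c, C, hC, hψ⟩ := hQ
  refine ⟨.and (φ.rename (spread 0) (spread 0)) (ψ.rename (spread 1) (spread 1)),
    interleave b c, fun n => interleave (B n) (C n), hB.interleave hC, fun a A hA => ?_⟩
  · refine and_congr ?_ ?_
    · rw [sat_rename N (spread_injective 0) (spread_injective 0)]
      simp only [interleave_spread_zero]
      exact hφ a A hA
    · rw [sat_rename N (spread_injective 1) (spread_injective 1)]
      simp only [interleave_spread_one]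
      exact hψ a A hA

theorem or {P Q : N.ObjAssign → N.RelAssign → Prop} (hP : N.Dfn P) (hQ : N.Dfn Q) :
    N.Dfn (fun a A => P a A ∨ Q a A) :=
  (hP.not.and hQ.not).not.congr fun a A _ => by tauto

theorem imp {P Q : N.ObjAssign → N.RelAssign → Prop} (hP : N.Dfn P) (hQ : N.Dfn Q) :
    N.Dfn (fun a A => P a A → Q a A) :=
  (hP.and hQ.not).not.congr fun a A _ => by tauto

theorem iff {P Q : N.ObjAssign → N.RelAssign → Prop} (hP : N.Dfn P) (hQ : N.Dfn Q) :
    N.Dfn (fun a A => (P a A ↔ Q a A)) :=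
  ((hP.imp hQ).and (hQ.imp hP)).congr fun a A _ => by tauto

/-- Quantification over objects.  The variable `k` must not occur in `Q`, which is what the second
hypothesis says. -/
theorem all (k : ℕ) {Q : N.ObjAssign → N.RelAssign → N.carrier → Prop}
    (h : N.Dfn (fun a A => Q a A (a k)))
    (fresh : ∀ a A m m', Q (Function.update a k m') A m ↔ Q a A m := by intros; simp) :
    N.Dfn (fun a A => ∀ m, Q a A m) := by
  obtain ⟨φ, b, B, hB, hφ⟩ := h
  refine ⟨.allObj (2 * k) φ, b, B, hB, fun a A hA => forall_congr' fun m => ?_⟩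
  rw [update_interleave]
  refine (hφ _ A hA).trans ?_
  rw [← fresh a A m m]; simp only [Function.update_self]

theorem ex (k : ℕ) {Q : N.ObjAssign → N.RelAssign → N.carrier → Prop}
    (h : N.Dfn (fun a A => Q a A (a k)))
    (fresh : ∀ a A m m', Q (Function.update a k m') A m ↔ Q a A m := by intros; simp) :
    N.Dfn (fun a A => ∃ m, Q a A m) :=
  (all k (Q := fun a A m => ¬ Q a A m) h.not (fun a A m m' => not_congr (fresh a A m m'))).not.congr fun a A _ => by simp

/-- Quantification over relations of sort `n`; the variable `k` must not occur in `Q`. -/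
theorem allRel (n k : ℕ) {Q : N.ObjAssign → N.RelAssign → Set (Fin (n + 1) → N.carrier) → Prop}
    (h : N.Dfn (fun a A => Q a A (A n k)))
    (fresh : ∀ a A R R', Q a (N.setRel A n k R') R ↔ Q a A R := by
      intros; simp [Frame.setRel_of_index_ne, Frame.setRel_of_sort_ne]) :
    N.Dfn (fun a A => ∀ R ∈ N.Rel n, Q a A R) := by
  obtain ⟨φ, b, B, hB, hφ⟩ := h
  refine ⟨.allRel n (2 * k) φ, b, B, hB, fun a A hA => forall₂_congr fun R hR => ?_⟩
  have : N.setRel (fun n => interleave (A n) (B n)) n (2 * k) R =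
      fun j => interleave (N.setRel A n k R j) (B j) := by
    funext j
    by_cases hj : j = n
    · subst hj
      simp only [Frame.setRel, Function.update_self, update_interleave]
    · simp only [Frame.setRel, Function.update_of_ne hj]
  rw [this]
  refine (hφ _ _ (hA.setRel k hR)).trans ?_
  rw [← fresh a A R R]; simp only [Frame.setRel_self]

theorem exRel (n k : ℕ) {Q : N.ObjAssign → N.RelAssign → Set (Fin (n + 1) → N.carrier) → Prop}
    (h : N.Dfn (fun a A => Q a A (A n k)))
    (fresh : ∀ a A R R', Q a (N.setRel A n k R') R ↔ Q a A R := by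
      intros; simp [Frame.setRel_of_index_ne, Frame.setRel_of_sort_ne]) :
    N.Dfn (fun a A => ∃ R ∈ N.Rel n, Q a A R) :=
  (allRel n k (Q := fun a A R => ¬ Q a A R) h.not (fun a A m m' => not_congr (fresh a A m m'))).not.congr fun a A _ => by simp

/-- Quantification over concepts; the variable `k` must not occur in `Q`. -/
theorem allConcept (k : ℕ) {Q : N.ObjAssign → N.RelAssign → Set N.carrier → Prop}
    (h : N.Dfn (fun a A => Q a A (Frame.ofRel (A 0 k))))
    (fresh : ∀ a A U R', Q a (N.setRel A 0 k R') U ↔ Q a A U := by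
      intros; simp [Frame.setRel_of_index_ne, Frame.setRel_of_sort_ne]) :
    N.Dfn (fun a A => ∀ U, N.IsConcept U → Q a A U) :=
  (allRel 0 k (Q := fun a A R => Q a A (Frame.ofRel R)) h
    (fun a A _ R' => fresh a A _ R')).congr fun _ _ _ =>
      ⟨fun H _ hR => H _ (Frame.isConcept_ofRel hR), fun H _ hU => H _ hU⟩

theorem exConcept (k : ℕ) {Q : N.ObjAssign → N.RelAssign → Set N.carrier → Prop}
    (h : N.Dfn (fun a A => Q a A (Frame.ofRel (A 0 k))))
    (fresh : ∀ a A U R', Q a (N.setRel A 0 k R') U ↔ Q a A U := by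
      intros; simp [Frame.setRel_of_index_ne, Frame.setRel_of_sort_ne]) :
    N.Dfn (fun a A => ∃ U, N.IsConcept U ∧ Q a A U) :=
  (allConcept k (Q := fun a A U => ¬ Q a A U) h.not (fun a A m m' => not_congr (fresh a A m m'))).not.congr fun a A _ => by simp

theorem eq (i j : ℕ) : N.Dfn (fun a _ => a i = a j) := by
  obtain ⟨B, hB⟩ := N.exists_admissible
  refine ⟨.eq (2 * i) (2 * j), fun _ => N.nonempty.some, B, hB, fun a A _ => ?_⟩
  simp only [Sat, interleave_even]

theorem eqConst (i : ℕ) (c : N.carrier) : N.Dfn (fun a _ => a i = c) := by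
  obtain ⟨B, hB⟩ := N.exists_admissible
  refine ⟨.eq (2 * i) (2 * 0 + 1), fun _ => c, B, hB, fun a A _ => ?_⟩
  simp only [Sat, interleave_even, interleave_odd]

theorem app (n k : ℕ) (x : Fin (n + 1) → ℕ) : N.Dfn (fun a A => (fun i => a (x i)) ∈ A n k) := by
  obtain ⟨B, hB⟩ := N.exists_admissible
  refine ⟨.app n (2 * k) (fun i => 2 * x i), fun _ => N.nonempty.some, B, hB, fun a A _ => ?_⟩
  simp only [Sat, interleave_even]

theorem appConst {n : ℕ} {R : Set (Fin (n + 1) → N.carrier)} (hR : R ∈ N.Rel n)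
    (x : Fin (n + 1) → ℕ) : N.Dfn (fun a _ => (fun i => a (x i)) ∈ R) := by
  obtain ⟨B, hB⟩ := N.exists_admissible
  refine ⟨.app n (2 * 0 + 1) (fun i => 2 * x i), fun _ => N.nonempty.some,
    N.setRel B n 0 R, hB.setRel 0 hR, fun a A _ => ?_⟩
  simp only [Sat, interleave_even, interleave_odd, Frame.setRel_self]

theorem memVar (i k : ℕ) : N.Dfn (fun a A => a i ∈ Frame.ofRel (A 0 k)) :=
  app 0 k (fun _ => i)

theorem mem (i : ℕ) {X : Set N.carrier} (hX : N.IsConcept X) : N.Dfn (fun a _ => a i ∈ X) :=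
  appConst (n := 0) hX (fun _ => i)

theorem pairVar (i j k : ℕ) : N.Dfn (fun a A => ![a i, a j] ∈ A 1 k) :=
  (app 1 k ![i, j]).congr fun a A _ => by
    rw [show ![a i, a j] = (fun l => a (![i, j] l)) by funext l; fin_cases l <;> rfl]

theorem pair (i j : ℕ) {R : Set (Fin 2 → N.carrier)} (hR : R ∈ N.Rel 1) :
    N.Dfn (fun a _ => ![a i, a j] ∈ R) :=
  (appConst (n := 1) hR ![i, j]).congr fun a A _ => by
    rw [show ![a i, a j] = (fun l => a (![i, j] l)) by funext l; fin_cases l <;> rfl]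

theorem triple (i j k : ℕ) {R : Set (Fin 3 → N.carrier)} (hR : R ∈ N.Rel 2) :
    N.Dfn (fun a _ => ![a i, a j, a k] ∈ R) :=
  (appConst (n := 2) hR ![i, j, k]).congr fun a A _ => by
    rw [show ![a i, a j, a k] = (fun l => a (![i, j, k] l)) by funext l; fin_cases l <;> rfl]

theorem graph (i j : ℕ) {f : N.carrier → N.carrier} {X : Set N.carrier} (h : N.HasFun f X) :
    N.Dfn (fun a _ => a i ∈ X ∧ a j = f (a i)) :=
  pair i j h

theorem const (p : Prop) : N.Dfn (fun _ _ => p) := by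
  by_cases hp : p
  · exact (eq 0 0).congr fun a A _ => by simp [hp]
  · exact (eq 0 0).not.congr fun a A _ => by simp [hp]

end Dfn

/-- Comprehension for definable predicates. -/
theorem Comprehension.mem_rel (hN : N.Comprehension) {n : ℕ}
    {Q : (Fin (n + 1) → N.carrier) → Prop}
    (h : N.Dfn (fun a _ => Q (fun i => a i))) : {y | Q y} ∈ N.Rel n := by
  obtain ⟨φ, b, B, hB, hφ⟩ := h
  obtain ⟨A, hA⟩ := N.exists_admissible
  -- the comprehended variables are named `0, …, n` in `Comprehension`, but `0, 2, …, 2n` in `φ`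
  let ρ : ℕ → ℕ := fun i => if i % 2 = 0 ∧ i / 2 < n + 1 then i / 2 else n + 1 + i
  have hρ : ρ.Injective := by
    intro i j hij
    dsimp only [ρ] at hij
    split_ifs at hij <;> omega
  let c : N.carrier := N.nonempty.some
  have key := hN n (φ.rename ρ id)
    (fun i => interleave (fun _ => c) b (i - (n + 1))) (fun n => interleave (A n) (B n))
    (hA.interleave hB)
  convert key using 1
  ext y
  rw [Set.mem_ofPred_eq, Set.mem_ofPred_eq, sat_rename N hρ Function.injective_id]
  have e : (fun i => if h : ρ i < n + 1 then y ⟨ρ i, h⟩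
      else interleave (fun _ => c) b (ρ i - (n + 1))) =
      interleave (fun i => if h : i < n + 1 then y ⟨i, h⟩ else c) b := by
    funext i
    rcases Nat.even_or_odd' i with ⟨j, rfl | rfl⟩
    · rw [interleave_even]
      by_cases hj : j < n + 1
      · have : ρ (2 * j) = j := by simp only [ρ]; rw [if_pos (by omega)]; omega
        simp only [this, hj, dite_true]
      · have : ρ (2 * j) = n + 1 + 2 * j := by simp only [ρ]; rw [if_neg (by omega)]
        rw [dif_neg (by omega), dif_neg hj, this, show n + 1 + 2 * j - (n + 1) = 2 * j by omega,
          interleave_even]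
    · have : ρ (2 * j + 1) = n + 1 + (2 * j + 1) := by
        have : ¬ ((2 * j + 1) % 2 = 0 ∧ (2 * j + 1) / 2 < n + 1) := by omega
        simp only [ρ, if_neg this]
      rw [dif_neg (by omega), this, show n + 1 + (2 * j + 1) - (n + 1) = 2 * j + 1 by omega,
        interleave_odd, interleave_odd]
  rw [e]
  have := hφ (fun i => if h : i < n + 1 then y ⟨i, h⟩ else c) A hA
  simp only [id]
  rw [this]
  have e' : (fun i : Fin (n + 1) => if h : (i : ℕ) < n + 1 then y ⟨i, h⟩ else c) = y := by
    funext i; rw [dif_pos i.2]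
  exact iff_of_eq (congrArg Q e'.symm)

theorem Comprehension.isConcept (hN : N.Comprehension) {Q : N.carrier → Prop}
    (h : N.Dfn (fun a _ => Q (a 0))) : N.IsConcept {m | Q m} :=
  hN.mem_rel (n := 0) (Q := fun y => Q (y 0)) h

theorem Comprehension.mem_rel_one (hN : N.Comprehension) {Q : N.carrier → N.carrier → Prop}
    (h : N.Dfn (fun a _ => Q (a 0) (a 1))) : {y : Fin 2 → N.carrier | Q (y 0) (y 1)} ∈ N.Rel 1 :=
  hN.mem_rel (n := 1) (Q := fun y => Q (y 0) (y 1)) h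

theorem Comprehension.hasFun (hN : N.Comprehension) {f : N.carrier → N.carrier}
    {X : Set N.carrier} (h : N.Dfn (fun a _ => a 0 ∈ X ∧ a 1 = f (a 0))) : N.HasFun f X :=
  hN.mem_rel_one (Q := fun x y => x ∈ X ∧ y = f x) h

/-- Cardinal well-foundedness for predicates of concepts that are definable with parameters in the
pure language. -/
theorem exists_cardLe_minimal {M : Frame.{u}} (hM : M.CardinalsWellFounded)
    {P : Set M.carrier → Prop} (hP : M.toPure.Dfn (fun _ A => P (Frame.ofRel (A 0 0))))
    {X : Set M.carrier} (hX : M.IsConcept X) (hPX : P X) :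
    ∃ Z, M.IsConcept Z ∧ P Z ∧ ∀ Y, M.IsConcept Y → P Y → M.CardLe Z Y := by
  obtain ⟨φ, b, B, hB, hφ⟩ := hP
  obtain ⟨A, hA⟩ := M.exists_admissible
  let a : M.ObjAssign := interleave (fun _ => M.nonempty.some) b
  let A' : M.RelAssign := fun n => interleave (A n) (B n)
  have hA' : M.Admissible A' := hA.interleave hB
  have key : ∀ Y, M.IsConcept Y → (M.SatAt φ a A' Y ↔ P Y) := by
    intro Y hY
    have e : M.setRel A' 0 0 (M.asRel Y) =
        fun n => interleave (M.setRel A 0 0 (M.asRel Y) n) (B n) := by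
      funext n
      by_cases hn : n = 0
      · subst hn
        simp only [Frame.setRel, Function.update_self]
        exact update_interleave _ _ 0 _
      · simp only [Frame.setRel, Function.update_of_ne hn, A']
    have h1 : M.SatAt φ a A' Y ↔ P (Frame.ofRel (M.setRel A 0 0 (M.asRel Y) 0 0)) := by
      unfold Frame.SatAt
      rw [e]
      exact hφ _ _ (hA.setRel 0 hY)
    rw [h1, Frame.setRel_self, Frame.ofRel_asRel]
  obtain ⟨Z, hZ, hPZ, hmin⟩ := hM φ a A' hA' ⟨X, hX, (key X hX).2 hPX⟩
  exact ⟨Z, hZ, (key Z hZ).1 hPZ, fun Y hY hPY => hmin Y hY ((key Y hY).2 hPY)⟩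

end Structure

end SOL

/-! ### Concepts and functions inside a model of comprehension -/

namespace SOL

namespace Frame

variable {M : Frame.{u}} {X Y : Set M.carrier} {f : M.carrier → M.carrier}

theorem cardEq_image (hf : M.HasFun f X) (hi : Set.InjOn f X) : M.CardEq X (f '' X) :=
  ⟨f, hf, hi.bijOn_image⟩

theorem CardEq.cardLe (h : M.CardEq X Y) : M.CardLe X Y := by
  obtain ⟨f, hf, hb⟩ := h
  exact ⟨f, hf, hb.mapsTo, hb.injOn⟩

end Frame

namespace Structure.Comprehension

variable {L : Signature.{v}} {N : Structure.{u, v} L} (hN : N.Comprehension)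
  {X Y Z X' Y' : Set N.carrier} {f g : N.carrier → N.carrier}
include hN

theorem isConcept_univ : N.IsConcept Set.univ :=
  hN.isConcept (Q := fun m => m ∈ Set.univ) (Dfn.const True)

theorem isConcept_empty : N.IsConcept ∅ :=
  hN.isConcept (Q := fun m => m ∈ (∅ : Set N.carrier)) (Dfn.const False)

theorem isConcept_singleton (c : N.carrier) : N.IsConcept {c} :=
  hN.isConcept (Q := fun m => m = c) (Dfn.eqConst 0 c)

theorem isConcept_compl (hX : N.IsConcept X) : N.IsConcept Xᶜ :=
  hN.isConcept (Q := fun m => ¬ m ∈ X) (Dfn.mem 0 hX).not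

theorem isConcept_union (hX : N.IsConcept X) (hY : N.IsConcept Y) : N.IsConcept (X ∪ Y) :=
  hN.isConcept (Q := fun m => m ∈ X ∨ m ∈ Y) ((Dfn.mem 0 hX).or (Dfn.mem 0 hY))

theorem isConcept_inter (hX : N.IsConcept X) (hY : N.IsConcept Y) : N.IsConcept (X ∩ Y) :=
  hN.isConcept (Q := fun m => m ∈ X ∧ m ∈ Y) ((Dfn.mem 0 hX).and (Dfn.mem 0 hY))

theorem isConcept_diff (hX : N.IsConcept X) (hY : N.IsConcept Y) : N.IsConcept (X \ Y) :=
  hN.isConcept (Q := fun m => m ∈ X ∧ ¬ m ∈ Y) ((Dfn.mem 0 hX).and (Dfn.mem 0 hY).not)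

theorem isConcept_dom (hf : N.HasFun f X) : N.IsConcept X := by
  have := hN.isConcept (Q := fun m => ∃ y, m ∈ X ∧ y = f m)
    (Dfn.ex 1 (Dfn.graph 0 1 hf))
  simpa using this

theorem isConcept_image (hf : N.HasFun f X) : N.IsConcept (f '' X) := by
  have := hN.isConcept (Q := fun m => ∃ x, x ∈ X ∧ m = f x) (Dfn.ex 1 (Dfn.graph 1 0 hf))
  convert this using 1
  ext m
  exact exists_congr fun x => and_congr_right fun _ => eq_comm

theorem hasFun_id (hX : N.IsConcept X) : N.HasFun id X :=
  hN.hasFun ((Dfn.mem 0 hX).and (Dfn.eq 1 0))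

theorem hasFun_mono (hf : N.HasFun f X) (hY : N.IsConcept Y) (h : Y ⊆ X) : N.HasFun f Y :=
  hN.hasFun (((Dfn.mem 0 hY).and (Dfn.graph 0 1 hf)).congr fun _ _ _ =>
    ⟨fun H => ⟨H.1, h H.1, H.2⟩, fun H => ⟨H.1, H.2.2⟩⟩)

theorem hasFun_comp (hf : N.HasFun f X) (hg : N.HasFun g Y) (h : Set.MapsTo f X Y) :
    N.HasFun (g ∘ f) X :=
  hN.hasFun ((Dfn.ex 2 (Q := fun a _ m => (a 0 ∈ X ∧ m = f (a 0)) ∧ (m ∈ Y ∧ a 1 = g m))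
    ((Dfn.graph 0 2 hf).and (Dfn.graph 2 1 hg))).congr fun a _ _ =>
    ⟨fun H => ⟨_, ⟨H.1, rfl⟩, h H.1, H.2⟩, by
      rintro ⟨m, ⟨h0, rfl⟩, -, h1⟩
      exact ⟨h0, h1⟩⟩)

theorem hasFun_invFunOn [Nonempty N.carrier] (hf : N.HasFun f X) (hi : Set.InjOn f X) :
    N.HasFun (Function.invFunOn f X) (f '' X) := by
  refine hN.hasFun ((Dfn.graph 1 0 hf).congr fun a _ _ => ⟨?_, ?_⟩)
  · rintro ⟨⟨x, hx, h0⟩, h1⟩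
    rw [← h0, hi.leftInvOn_invFunOn hx] at h1
    rw [h1]
    exact ⟨hx, h0.symm⟩
  · rintro ⟨hx, h0⟩
    rw [h0]
    exact ⟨⟨_, hx, rfl⟩, (hi.leftInvOn_invFunOn hx).symm⟩

open Classical in
theorem hasFun_piecewise (hf : N.HasFun f X) (hg : N.HasFun g Y) :
    N.HasFun (X.piecewise f g) (X ∪ Y) := by
  refine hN.hasFun (((Dfn.graph 0 1 hf).or
    ((Dfn.mem 0 (hN.isConcept_dom hf)).not.and (Dfn.graph 0 1 hg))).congr fun a _ _ => ?_)
  by_cases h : a 0 ∈ X <;> simp [h]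

/-! ### Equinumerosity and comparison -/

theorem cardEq_refl (hX : N.IsConcept X) : N.CardEq X X :=
  ⟨id, hN.hasFun_id hX, Set.bijOn_id X⟩

theorem cardEq_symm (h : N.CardEq X Y) : N.CardEq Y X := by
  obtain ⟨f, hf, hb⟩ := h
  have := N.nonempty
  refine ⟨Function.invFunOn f X, ?_, ?_⟩
  · have := hN.hasFun_invFunOn hf hb.injOn
    rwa [hb.image_eq] at this
  · exact Set.InvOn.bijOn ⟨hb.surjOn.rightInvOn_invFunOn, hb.injOn.leftInvOn_invFunOn⟩
      hb.surjOn.mapsTo_invFunOn hb.mapsTo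

theorem cardEq_trans (h₁ : N.CardEq X Y) (h₂ : N.CardEq Y Z) : N.CardEq X Z := by
  obtain ⟨f, hf, hfb⟩ := h₁
  obtain ⟨g, hg, hgb⟩ := h₂
  exact ⟨g ∘ f, hN.hasFun_comp hf hg hfb.mapsTo, hgb.comp hfb⟩

open Classical in
/-- Two internal bijections with disjoint domains and disjoint ranges have a common extension. -/
theorem exists_glue (hf : N.HasFun f X) (hfb : Set.BijOn f X X') (hg : N.HasFun g Y)
    (hgb : Set.BijOn g Y Y') (hd : Disjoint X Y) (hd' : Disjoint X' Y') :
    ∃ h, N.HasFun h (X ∪ Y) ∧ Set.BijOn h (X ∪ Y) (X' ∪ Y') ∧ Set.EqOn h f X ∧ Set.EqOn h g Y := by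
  have e₁ : Set.EqOn (X.piecewise f g) f X := Set.piecewise_eqOn X f g
  have e₂ : Set.EqOn (X.piecewise f g) g Y := fun y hy =>
    Set.piecewise_eq_of_notMem X f g (Set.disjoint_right.1 hd hy)
  refine ⟨X.piecewise f g, hN.hasFun_piecewise hf hg, ?_, e₁, e₂⟩
  refine (hfb.congr e₁.symm).union (hgb.congr e₂.symm) ?_
  rw [Set.injOn_union hd]
  refine ⟨hfb.injOn.congr e₁.symm, hgb.injOn.congr e₂.symm, fun x hx y hy => ?_⟩
  rw [e₁ hx, e₂ hy]
  exact fun h => Set.disjoint_left.1 hd' (hfb.mapsTo hx) (h ▸ hgb.mapsTo hy)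

theorem cardEq_union (h₁ : N.CardEq X X') (h₂ : N.CardEq Y Y') (hd : Disjoint X Y)
    (hd' : Disjoint X' Y') : N.CardEq (X ∪ Y) (X' ∪ Y') := by
  obtain ⟨f, hf, hfb⟩ := h₁
  obtain ⟨g, hg, hgb⟩ := h₂
  obtain ⟨h, hh, hb, -, -⟩ := hN.exists_glue hf hfb hg hgb hd hd'
  exact ⟨h, hh, hb⟩

/-- Bijections of `X` onto `X'` and of the complements combine to a permutation of the objects. -/
theorem exists_perm (hf : N.HasFun f X) (hfb : Set.BijOn f X X') (hg : N.HasFun g Xᶜ)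
    (hgb : Set.BijOn g Xᶜ X'ᶜ) :
    ∃ π : Equiv.Perm N.carrier, N.HasFun π Set.univ ∧ Set.EqOn π f X ∧ Set.EqOn π g Xᶜ := by
  obtain ⟨h, hh, hb, e₁, e₂⟩ :=
    hN.exists_glue hf hfb hg hgb disjoint_compl_right disjoint_compl_right
  rw [Set.union_compl_self] at hh
  rw [Set.union_compl_self, Set.union_compl_self, Set.bijOn_univ] at hb
  exact ⟨Equiv.ofBijective h hb, hh, e₁, e₂⟩

/-- Pairs of concepts whose Venn diagrams have equinumerous cells are conjugate. -/
theorem exists_perm_of_cells {A B A' B' : Set N.carrier} (h₁ : N.CardEq (A ∩ B) (A' ∩ B'))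
    (h₂ : N.CardEq (A \ B) (A' \ B')) (h₃ : N.CardEq (B \ A) (B' \ A'))
    (h₄ : N.CardEq (A ∪ B)ᶜ (A' ∪ B')ᶜ) :
    ∃ π : Equiv.Perm N.carrier, N.HasFun π Set.univ ∧ π '' A = A' ∧ π '' B = B' := by
  have split : ∀ C D : Set N.carrier, C ∩ D ∪ C \ D = C ∧ D \ C ∪ (C ∪ D)ᶜ = Cᶜ := fun C D =>
    ⟨Set.inter_union_sdiff C D, by ext x; simp; tauto⟩
  have disj : ∀ C D : Set N.carrier, Disjoint (C ∩ D) (C \ D) ∧ Disjoint (D \ C) (C ∪ D)ᶜ :=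
    fun C D => ⟨Set.disjoint_left.2 fun x h h' => h'.2 h.2,
      Set.disjoint_left.2 fun x h h' => h' (Or.inr h.1)⟩
  obtain ⟨f₁, hf₁, hb₁⟩ := h₁
  obtain ⟨f₂, hf₂, hb₂⟩ := h₂
  obtain ⟨f₃, hf₃, hb₃⟩ := h₃
  obtain ⟨f₄, hf₄, hb₄⟩ := h₄
  obtain ⟨f, hf, hfb, e₁, -⟩ :=
    hN.exists_glue hf₁ hb₁ hf₂ hb₂ (disj A B).1 (disj A' B').1
  obtain ⟨g, hg, hgb, e₃, -⟩ :=
    hN.exists_glue hf₃ hb₃ hf₄ hb₄ (disj A B).2 (disj A' B').2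
  rw [(split A B).1] at hf
  rw [(split A B).1, (split A' B').1] at hfb
  rw [(split A B).2] at hg
  rw [(split A B).2, (split A' B').2] at hgb
  obtain ⟨π, hπ, ef, eg⟩ := hN.exists_perm hf hfb hg hgb
  refine ⟨π, hπ, by rw [ef.image_eq, hfb.image_eq], ?_⟩
  have hB : ∀ C D : Set N.carrier, D = C ∩ D ∪ D \ C := fun C D => by
    rw [Set.inter_comm, Set.inter_union_sdiff]
  rw [hB A B, Set.image_union, hB A' B',
    (ef.mono Set.inter_subset_left).image_eq, e₁.image_eq, hb₁.image_eq,
    (eg.mono (Set.disjoint_left.1 disjoint_sdiff_self_left)).image_eq, e₃.image_eq, hb₃.image_eq]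

theorem cardLe_of_subset (hX : N.IsConcept X) (h : X ⊆ Y) : N.CardLe X Y :=
  ⟨id, hN.hasFun_id hX, h, Set.injOn_id X⟩

theorem cardLe_trans (h₁ : N.CardLe X Y) (h₂ : N.CardLe Y Z) : N.CardLe X Z := by
  obtain ⟨f, hf, hfm, hfi⟩ := h₁
  obtain ⟨g, hg, hgm, hgi⟩ := h₂
  exact ⟨g ∘ f, hN.hasFun_comp hf hg hfm, hgm.comp hfm, hgi.comp hfi hfm⟩

theorem exists_subset_of_cardLe (h : N.CardLe X Y) :
    ∃ Z, Z ⊆ Y ∧ N.IsConcept Z ∧ N.CardEq X Z := by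
  obtain ⟨f, hf, hm, hi⟩ := h
  exact ⟨f '' X, hm.image_subset, hN.isConcept_image hf, Frame.cardEq_image hf hi⟩

theorem cardLe_union (h₁ : N.CardLe X X') (h₂ : N.CardLe Y Y') (hd : Disjoint X Y)
    (hd' : Disjoint X' Y') : N.CardLe (X ∪ Y) (X' ∪ Y') := by
  obtain ⟨U, hU, hUc, hXU⟩ := hN.exists_subset_of_cardLe h₁
  obtain ⟨V, hV, hVc, hYV⟩ := hN.exists_subset_of_cardLe h₂
  exact hN.cardLe_trans (Frame.CardEq.cardLe (hN.cardEq_union hXU hYV hd (hd'.mono hU hV)))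
    (hN.cardLe_of_subset (hN.isConcept_union hUc hVc) (Set.union_subset_union hU hV))

theorem infinite_mono (hX : N.Infinite X) (h : N.CardLe X Y) (hY : N.IsConcept Y) :
    N.Infinite Y := by
  obtain ⟨Z, hZ, hZX, hle⟩ := hX
  obtain ⟨f, hf, hm, hi⟩ := h
  obtain ⟨x, hx, hxZ⟩ := Set.exists_of_ssubset hZX
  have hfZ : N.HasFun f Z := hN.hasFun_mono hf hZ hZX.subset
  have hXi := hN.isConcept_image hf
  have hZi := hN.isConcept_image hfZ
  have hYX := hN.isConcept_diff hY hXi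
  have hsub : f '' Z ⊆ f '' X := Set.image_mono hZX.subset
  refine ⟨f '' Z ∪ (Y \ f '' X), hN.isConcept_union hZi hYX,
    ⟨Set.union_subset (hsub.trans hm.image_subset) Set.sdiff_subset, fun hsup => ?_⟩, ?_⟩
  · rcases hsup (hm hx) with ⟨z, hz, hzx⟩ | h
    · exact hxZ (hi (hZX.subset hz) hx hzx ▸ hz)
    · exact h.2 ⟨x, hx, rfl⟩
  · have e : Y = f '' X ∪ (Y \ f '' X) := (Set.union_sdiff_cancel hm.image_subset).symm
    have h1 : N.CardLe (f '' X) (f '' Z) :=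
      hN.cardLe_trans (Frame.CardEq.cardLe (hN.cardEq_symm (Frame.cardEq_image hf hi)))
        (hN.cardLe_trans hle
          (Frame.CardEq.cardLe (Frame.cardEq_image hfZ (hi.mono hZX.subset))))
    have h2 := hN.cardLe_union h1 (hN.cardLe_of_subset hYX subset_rfl) Set.disjoint_sdiff_right
      (Set.disjoint_sdiff_right.mono_left hsub)
    rwa [← e] at h2

/-! ### Arithmetic of infinite concepts -/

variable (hW : N.toFrame.WellBehaved)
include hW

/-- If `|X| ≤ |Y|` are infinite, `Y` is the disjoint union of copies of `X` and `Y`. -/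
theorem exists_partition (hX : N.IsConcept X) (hY : N.IsConcept Y) (hXi : N.Infinite X)
    (hle : N.CardLe X Y) :
    ∃ U V, N.IsConcept U ∧ N.IsConcept V ∧ Disjoint U V ∧ U ∪ V = Y ∧ N.CardEq X U ∧
      N.CardEq Y V := by
  obtain ⟨f, g, hf, hg, hfi, hgi, hd, hu⟩ :=
    (hW.sums X Y hX hY hXi (hN.infinite_mono hXi hle hY)).1 hle
  exact ⟨f '' X, g '' Y, hN.isConcept_image hf, hN.isConcept_image hg, hd, hu,
    Frame.cardEq_image hf hfi, Frame.cardEq_image hg hgi⟩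

/-- The Schröder–Bernstein theorem for infinite concepts: both are of the size of their sum. -/
theorem cardEq_of_cardLe (hX : N.IsConcept X) (hY : N.IsConcept Y) (hXi : N.Infinite X)
    (h₁ : N.CardLe X Y) (h₂ : N.CardLe Y X) : N.CardEq X Y := by
  obtain ⟨U, V, hU, hV, hd, rfl, hXU, hYV⟩ := hN.exists_partition hW hX hY hXi h₁
  obtain ⟨V', U', hV', hU', hd', e, hYV', hXU'⟩ :=
    hN.exists_partition hW hY hX (hN.infinite_mono hXi h₁ hY) h₂
  have := hN.cardEq_union (hN.cardEq_trans (hN.cardEq_symm hXU') hXU)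
    (hN.cardEq_trans (hN.cardEq_symm hYV') hYV) hd'.symm hd
  rwa [Set.union_comm, e] at this

/-- Disjoint copies of `X` and `Y` inside any concept that is at least as large as `Y`. -/
theorem exists_disjoint_subsets (hX : N.IsConcept X) (hXi : N.Infinite X) (h₁ : N.CardLe X Y)
    (h₂ : N.CardLe Y Z) :
    ∃ U V, U ⊆ Z ∧ V ⊆ Z ∧ N.IsConcept U ∧ N.IsConcept V ∧ Disjoint U V ∧ N.CardEq X U ∧
      N.CardEq Y V := by
  obtain ⟨W, hWZ, hWc, hYW⟩ := hN.exists_subset_of_cardLe h₂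
  obtain ⟨U, V, hU, hV, hd, e, hXU, hWV⟩ := hN.exists_partition hW hX hWc hXi
    (hN.cardLe_trans h₁ (Frame.CardEq.cardLe hYW))
  exact ⟨U, V, (Set.subset_union_left.trans_eq e).trans hWZ,
    (Set.subset_union_right.trans_eq e).trans hWZ, hU, hV, hd, hXU, hN.cardEq_trans hYW hWV⟩

theorem union_cardLe (hX : N.IsConcept X) (hY : N.IsConcept Y) (hZ : N.IsConcept Z)
    (hZi : N.Infinite Z) (h₁ : N.CardLe X Z) (h₂ : N.CardLe Y Z) : N.CardLe (X ∪ Y) Z := by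
  obtain ⟨U, V, hU, hV, hd, e, hZU, hZV⟩ :=
    hN.exists_partition hW hZ hZ hZi (hN.cardLe_of_subset hZ subset_rfl)
  have h₃ : N.CardLe (Y \ X) V := hN.cardLe_trans (hN.cardLe_of_subset (hN.isConcept_diff hY hX)
    Set.sdiff_subset) (hN.cardLe_trans h₂ (Frame.CardEq.cardLe hZV))
  have := hN.cardLe_union (hN.cardLe_trans h₁ (Frame.CardEq.cardLe hZU)) h₃
    Set.disjoint_sdiff_right hd
  rwa [Set.union_sdiff_self, e] at this

/-- The coordinates of a bijection from `X` onto `X × X`. -/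
theorem exists_coordinates (hX : N.IsConcept X) (hXi : N.Infinite X) :
    ∃ p q : N.carrier → N.carrier, N.HasFun p X ∧ N.HasFun q X ∧ Set.MapsTo p X X ∧
      Set.MapsTo q X X ∧ Set.InjOn (fun w => (p w, q w)) X ∧
      ∀ x ∈ X, ∀ y ∈ X, ∃ w ∈ X, p w = x ∧ q w = y := by
  obtain ⟨h, hh, hb⟩ := (hW.products X X hX hX hXi hXi).1 (hN.cardLe_of_subset hX subset_rfl)
  have := N.nonempty
  obtain ⟨k, hkm, hk₁, hk₂⟩ : ∃ k : N.carrier → N.carrier × N.carrier,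
      Set.MapsTo k X (X ×ˢ X) ∧ (∀ w ∈ X, h (k w) = w) ∧ ∀ z ∈ X ×ˢ X, k (h z) = z :=
    ⟨Function.invFunOn h (X ×ˢ X), hb.surjOn.mapsTo_invFunOn,
      fun w hw => hb.surjOn.rightInvOn_invFunOn hw,
      fun z hz => hb.injOn.leftInvOn_invFunOn hz⟩
  have tri : ∀ i j l, N.Dfn (fun a _ => a i ∈ X ∧ a j ∈ X ∧ a l = h (a i, a j)) := fun i j l =>
    Dfn.triple i j l hh
  refine ⟨fun w => (k w).1, fun w => (k w).2, ?_, ?_, fun w hw => (hkm hw).1,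
    fun w hw => (hkm hw).2, ?_, ?_⟩
  · refine hN.hasFun ((Dfn.ex 2 (Q := fun a _ m => a 1 ∈ X ∧ m ∈ X ∧ a 0 = h (a 1, m))
      (tri 1 2 0)).congr fun a _ _ => ⟨?_, ?_⟩)
    · rintro ⟨h0, h1⟩
      refine ⟨(k (a 0)).2, h1 ▸ (hkm h0).1, (hkm h0).2, ?_⟩
      rw [h1]; exact (hk₁ _ h0).symm
    · rintro ⟨m, h1, hm, h0⟩
      have hz : (a 1, m) ∈ X ×ˢ X := ⟨h1, hm⟩
      rw [h0, hk₂ _ hz]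
      exact ⟨hb.mapsTo hz, rfl⟩
  · refine hN.hasFun ((Dfn.ex 2 (Q := fun a _ m => m ∈ X ∧ a 1 ∈ X ∧ a 0 = h (m, a 1))
      (tri 2 1 0)).congr fun a _ _ => ⟨?_, ?_⟩)
    · rintro ⟨h0, h1⟩
      refine ⟨(k (a 0)).1, (hkm h0).1, h1 ▸ (hkm h0).2, ?_⟩
      rw [h1]; exact (hk₁ _ h0).symm
    · rintro ⟨m, hm, h1, h0⟩
      have hz : (m, a 1) ∈ X ×ˢ X := ⟨hm, h1⟩
      rw [h0, hk₂ _ hz]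
      exact ⟨hb.mapsTo hz, rfl⟩
  · intro w hw w' hw' e
    rw [← hk₁ w hw, ← hk₁ w' hw']
    exact congrArg h (by simpa [Prod.ext_iff] using e)
  · intro x hx y hy
    have hz : (x, y) ∈ X ×ˢ X := ⟨hx, hy⟩
    exact ⟨h (x, y), hb.mapsTo hz, congrArg Prod.fst (hk₂ _ hz), congrArg Prod.snd (hk₂ _ hz)⟩

/-- `X` is the domain of an internal self-map all of whose fibres have the size of `X`. -/
theorem exists_large_fibres (hX : N.IsConcept X) (hXi : N.Infinite X) :
    ∃ p : N.carrier → N.carrier, N.HasFun p X ∧ Set.MapsTo p X X ∧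
      ∀ x ∈ X, ∃ W, N.IsConcept W ∧ W ⊆ X ∧ (∀ w ∈ W, p w = x) ∧ N.CardLe X W := by
  obtain ⟨p, q, hp, hq, hpm, hqm, hi, hs⟩ := hN.exists_coordinates hW hX hXi
  refine ⟨p, hp, hpm, fun x hx => ?_⟩
  have hWc : N.IsConcept {w | w ∈ X ∧ x = p w} := by
    refine hN.isConcept (Q := fun w => w ∈ X ∧ x = p w)
      ((Dfn.ex 1 (Q := fun a _ m => m = x ∧ (a 0 ∈ X ∧ m = p (a 0)))
        ((Dfn.eqConst 1 x).and (Dfn.graph 0 1 hp))).congr fun a _ _ => ?_)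
    simp
  have hqi : Set.InjOn q {w | w ∈ X ∧ x = p w} := fun w hw w' hw' e =>
    hi hw.1 hw'.1 (Prod.ext (hw.2.symm.trans hw'.2) e)
  have hqW := hN.hasFun_mono hq hWc fun w hw => hw.1
  refine ⟨_, hWc, fun w hw => hw.1, fun w hw => hw.2.symm, ?_⟩
  have e : q '' {w | w ∈ X ∧ x = p w} = X := by
    apply Set.Subset.antisymm
    · rintro _ ⟨w, hw, rfl⟩; exact hqm hw.1
    · intro y hy
      obtain ⟨w, hw, h1, h2⟩ := hs x hx y hy
      exact ⟨w, ⟨hw, h1.symm⟩, h2⟩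
  have := Frame.CardEq.cardLe (hN.cardEq_symm (Frame.cardEq_image hqW hqi))
  rwa [e] at this

end Structure.Comprehension

/-! ### Exponentially large concepts -/

namespace Frame

variable {M : Frame.{u}}

theorem not_expl_iff {X : Set M.carrier} :
    ¬ M.Expl X ↔ ∃ R ∈ M.Rel 1, ∀ U, M.IsConcept U → U ⊆ X → ∃ x, M.section_ R x = U := by
  unfold Expl
  rw [not_not]
  refine exists_congr fun R => and_congr_right fun _ => ⟨fun h U hU hUX => ?_, fun h => ⟨?_, ?_⟩⟩
  · obtain ⟨x, -, hx⟩ := h.1 U hU hUX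
    exact ⟨x, hx⟩
  · intro U hU hUX
    obtain ⟨x, hx⟩ := h U hU hUX
    exact ⟨x, hx.subset, hx⟩
  · rintro x y hne rfl
    exact hne rfl

/-- Being exponentially large is expressible in the pure language. -/
theorem dfn_expl (M : Frame.{u}) : M.toPure.Dfn (fun _ A => M.Expl (ofRel (A 0 0))) := by
  have h : M.toPure.Dfn (fun _ A => ∃ R ∈ M.toPure.Rel 1, ∀ U, M.toPure.IsConcept U →
      (∀ m, m ∈ U → m ∈ ofRel (A 0 0)) → ∃ x, ∀ m, (![x, m] ∈ R ↔ m ∈ U)) := by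
    refine Structure.Dfn.exRel 1 0 ?_
    refine Structure.Dfn.allConcept 1 ?_
    refine Structure.Dfn.imp ?_ ?_
    · exact Structure.Dfn.all 0 ((Structure.Dfn.memVar 0 1).imp (Structure.Dfn.memVar 0 0))
    · exact Structure.Dfn.ex 0 (Structure.Dfn.all 1
        ((Structure.Dfn.pairVar 0 1 0).iff (Structure.Dfn.memVar 1 1)))
  refine h.not.congr fun a A _ => ?_
  rw [← not_iff_not, not_not, not_expl_iff]
  refine exists_congr fun R => and_congr_right fun _ => forall₂_congr fun U _ =>
    forall_congr' fun _ => exists_congr fun x => ?_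
  exact Set.ext_iff

end Frame

namespace Structure.Comprehension

variable {L : Signature.{v}} {N : Structure.{u, v} L} (hN : N.Comprehension)
  {X Y Z P Q : Set N.carrier}
include hN

/-- A concept is not exponentially large if its subconcepts are the sections of a definable
relation. -/
theorem not_expl_of_dfn {R : N.carrier → N.carrier → Prop}
    (hR : N.Dfn (fun a _ => R (a 0) (a 1)))
    (h : ∀ U, N.IsConcept U → U ⊆ X → ∃ x, ∀ y, R x y ↔ y ∈ U) : ¬ N.Expl X :=
  Frame.not_expl_iff.2 ⟨_, hN.mem_rel_one hR, fun U hU hUX =>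
    (h U hU hUX).imp fun _ hx => Set.ext hx⟩

theorem expl_mono (h : N.CardLe X Y) (hX : N.Expl X) : N.Expl Y := by
  by_contra hY
  obtain ⟨R, hR, hc⟩ := Frame.not_expl_iff.1 hY
  obtain ⟨f, hf, hm, hi⟩ := h
  refine hN.not_expl_of_dfn (X := X) (R := fun x z => ∃ w, (z ∈ X ∧ w = f z) ∧ ![x, w] ∈ R)
    (Dfn.ex 2 ((Dfn.graph 1 2 hf).and (Dfn.pair 0 2 hR))) (fun U hU hUX => ?_) hX
  obtain ⟨x, hx⟩ := hc (f '' U) (hN.isConcept_image (hN.hasFun_mono hf hU hUX))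
    ((Set.image_mono hUX).trans hm.image_subset)
  refine ⟨x, fun z => ⟨?_, fun hz => ⟨f z, ⟨hUX hz, rfl⟩, ?_⟩⟩⟩
  · rintro ⟨w, ⟨hz, rfl⟩, hw⟩
    obtain ⟨z', hz', e⟩ : f z ∈ f '' U := hx ▸ hw
    exact hi (hUX hz') hz e ▸ hz'
  · exact (Set.ext_iff.1 hx (f z)).2 ⟨z, hz, rfl⟩

theorem not_expl_empty : ¬ N.Expl ∅ :=
  hN.not_expl_of_dfn (R := fun _ _ => False) (Dfn.const False) fun _ _ hU =>
    ⟨N.nonempty.some, fun _ => ⟨False.elim, fun hy => hU hy⟩⟩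

theorem not_expl_singleton {b c : N.carrier} (h : b ≠ c) : ¬ N.Expl {c} := by
  refine hN.not_expl_of_dfn (R := fun x y => x = c ∧ y = c)
    ((Dfn.eqConst 0 c).and (Dfn.eqConst 1 c)) fun U _ hU => ?_
  rcases Set.subset_singleton_iff_eq.1 hU with rfl | rfl
  · exact ⟨b, fun y => by simp [h]⟩
  · exact ⟨c, fun y => by simp⟩

theorem not_expl_pair {a b c e : N.carrier} (hac : a ≠ c) (hae : a ≠ e) (hbc : b ≠ c) (hbe : b ≠ e)
    (hce : c ≠ e) (hab : a ≠ b) : ¬ N.Expl {a, b} := by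
  refine hN.not_expl_of_dfn (R := fun x y => (x = a ∧ y = a) ∨ (x = b ∧ y = b) ∨
      (x = c ∧ (y = a ∨ y = b)))
    (((Dfn.eqConst 0 a).and (Dfn.eqConst 1 a)).or (((Dfn.eqConst 0 b).and (Dfn.eqConst 1 b)).or
      ((Dfn.eqConst 0 c).and ((Dfn.eqConst 1 a).or (Dfn.eqConst 1 b))))) fun U _ hU => ?_
  rcases Set.subset_pair_iff_eq.1 hU with rfl | rfl | rfl | rfl
  · exact ⟨e, fun y => by simp [hae.symm, hbe.symm, hce.symm]⟩
  · exact ⟨a, fun y => by simp [hab, hac]⟩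
  · exact ⟨b, fun y => by simp [hab.symm, hbc]⟩
  · exact ⟨c, fun y => by simp [hac.symm, hbc.symm]⟩

variable (hW : N.toFrame.WellBehaved)
include hW

theorem expl_union (hP : N.IsConcept P) (hQ : N.IsConcept Q) (hu : N.Infinite Set.univ)
    (h : N.Expl (P ∪ Q)) : N.Expl P ∨ N.Expl Q := by
  by_contra hne
  rw [not_or, Frame.not_expl_iff, Frame.not_expl_iff] at hne
  obtain ⟨⟨R, hR, hRc⟩, S, hS, hSc⟩ := hne
  obtain ⟨p, q, hp, hq, -, -, -, hs⟩ := hN.exists_coordinates hW hN.isConcept_univ hu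
  refine hN.not_expl_of_dfn (X := P ∪ Q)
    (R := fun w z => (z ∈ P ∧ ∃ x, (w ∈ Set.univ ∧ x = p w) ∧ ![x, z] ∈ R) ∨
      (z ∈ Q ∧ ∃ y, (w ∈ Set.univ ∧ y = q w) ∧ ![y, z] ∈ S))
    (((Dfn.mem 1 hP).and (Dfn.ex 2 ((Dfn.graph 0 2 hp).and (Dfn.pair 2 1 hR)))).or
      ((Dfn.mem 1 hQ).and (Dfn.ex 2 ((Dfn.graph 0 2 hq).and (Dfn.pair 2 1 hS)))))
    (fun U hU hUX => ?_) h
  obtain ⟨x, hx⟩ := hRc (U ∩ P) (hN.isConcept_inter hU hP) Set.inter_subset_right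
  obtain ⟨y, hy⟩ := hSc (U ∩ Q) (hN.isConcept_inter hU hQ) Set.inter_subset_right
  obtain ⟨w, -, rfl, rfl⟩ := hs x trivial y trivial
  refine ⟨w, fun z => ?_⟩
  have h1 : ![p w, z] ∈ R ↔ z ∈ U ∩ P := Set.ext_iff.1 hx z
  have h2 : ![q w, z] ∈ S ↔ z ∈ U ∩ Q := Set.ext_iff.1 hy z
  have h3 : z ∈ U → z ∈ P ∨ z ∈ Q := fun hz => hUX hz
  simp only [Set.mem_univ, true_and, exists_eq_left, h1, h2, Set.mem_inter_iff]
  tauto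

/-- If there are infinitely many objects, an exponentially large concept of least size loses no
size when an element is removed, so exponentially large concepts are infinite. -/
theorem infinite_of_expl (hu : N.Infinite Set.univ) (hXc : N.IsConcept X) (hX : N.Expl X) :
    N.Infinite X := by
  obtain ⟨Z, hZ, hZe, hmin⟩ :=
    exists_cardLe_minimal hW.wellFounded N.toFrame.dfn_expl hXc hX
  obtain ⟨c, hc⟩ : Z.Nonempty := Set.nonempty_iff_ne_empty.2 fun h => hN.not_expl_empty (h ▸ hZe)
  obtain ⟨b, hb⟩ : ∃ b, b ≠ c := by
    obtain ⟨W, hW', hss, f, hf, hm, hi⟩ := hu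
    by_contra hb
    push Not at hb
    obtain ⟨x, -, hx⟩ := Set.exists_of_ssubset hss
    have h1 : f c ∈ W := hm trivial
    rw [hb x] at hx
    rw [hb (f c)] at h1
    exact hx h1
  have hd := hN.isConcept_diff hZ (hN.isConcept_singleton c)
  refine hN.infinite_mono ⟨Z \ {c}, hd, ?_, hmin _ hd ?_⟩ (hmin X hXc hX) hXc
  · exact ⟨Set.sdiff_subset, fun h => (h hc).2 rfl⟩
  · refine (hN.expl_union hW hd (hN.isConcept_singleton c) hu ?_).resolve_right
      (hN.not_expl_singleton hb)
    rwa [Set.sdiff_union_of_subset (Set.singleton_subset_iff.2 hc)]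

/-- An exponentially large size cannot be reached by a union of two smaller concepts. -/
theorem cardLe_or_of_expl (hu : N.Infinite Set.univ) (hP : N.IsConcept P)
    (hQ : N.IsConcept Q) (hX : N.Expl X) (h : N.CardLe X (P ∪ Q)) :
    N.CardLe X P ∨ N.CardLe X Q := by
  have h₁ := hN.expl_union hW hP hQ hu (hN.expl_mono h hX)
  rcases hW.comparability P Q hP hQ with hle | hle
  · have hQi := hN.infinite_of_expl hW hu hQ (h₁.elim (hN.expl_mono hle) id)
    exact Or.inr (hN.cardLe_trans h
      (hN.union_cardLe hW hP hQ hQ hQi hle (hN.cardLe_of_subset hQ subset_rfl)))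
  · have hPi := hN.infinite_of_expl hW hu hP (h₁.elim id (hN.expl_mono hle))
    exact Or.inl (hN.cardLe_trans h
      (hN.union_cardLe hW hP hQ hP hPi (hN.cardLe_of_subset hP subset_rfl) hle))

end Structure.Comprehension

/-! ### Models with infinitely many objects -/

namespace Structure

variable {L : Signature.{v}} {N : Structure.{u, v} L}

/-- The relation `x = d X` is definable in `N`. -/
def DfnAbs (N : Structure.{u, v} L) (d : Set N.carrier → N.carrier) : Prop :=
  ∀ i k, N.Dfn (fun a A => a i = d (Frame.ofRel (A 0 k)))

/-- `A` and `B` have at most the size of `X`, and their four-cell Venn diagram is as large as this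
permits: three cells of size at least `|X|`, the outer one of size at least `|M - X|`. -/
structure Generic (N : Structure.{u, v} L) (X A B : Set N.carrier) : Prop where
  left_le : N.CardLe A X
  right_le : N.CardLe B X
  le_inter : N.CardLe X (A ∩ B)
  le_left : N.CardLe X (A \ B)
  le_right : N.CardLe X (B \ A)
  le_outer : N.CardLe Xᶜ (A ∪ B)ᶜ

namespace Comprehension

variable (hN : N.Comprehension) {X Y A B A' B' : Set N.carrier}
  {E : Set N.carrier → Set N.carrier → Prop} {d : Set N.carrier → N.carrier}
include hN

/-- The values at concepts of a definable operation on concepts are concepts. -/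
theorem isConcept_of_dfn {F : Set N.carrier → Set N.carrier}
    (hF : N.Dfn (fun a A => a 0 ∈ F (Frame.ofRel (A 0 0)))) (hX : N.IsConcept X) :
    N.IsConcept (F X) := by
  refine hN.isConcept (Q := fun m => m ∈ F X) ((Dfn.exConcept 0
    (Q := fun a _ V => (∀ m, m ∈ V ↔ m ∈ X) ∧ a 0 ∈ F V) (Dfn.and (Dfn.all 1
      ((Dfn.memVar 1 0).iff (Dfn.mem 1 hX))) hF)).congr fun a _ _ => ⟨fun h => ?_, ?_⟩)
  · exact ⟨X, hX, fun _ => Iff.rfl, h⟩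
  · rintro ⟨V, -, hV, h⟩
    rwa [Set.ext hV] at h

/-- If a definable operation takes the subconcepts of `X` to concepts with distinct abstracts, then
the abstracts code the subconcepts of `X`. -/
theorem not_expl_of_injOn (hd : N.DfnAbs d) {F : Set N.carrier → Set N.carrier}
    (hF : ∀ i, N.Dfn (fun a A => a i ∈ F (Frame.ofRel (A 0 0)))) (hX : N.IsConcept X)
    (hinj : ∀ U V, N.IsConcept U → N.IsConcept V → U ⊆ X → V ⊆ X → d (F U) = d (F V) → U = V) :
    ¬ N.Expl X := by
  refine hN.not_expl_of_dfn (R := fun x y => ∃ U, N.IsConcept U ∧ ((∀ m, m ∈ U → m ∈ X) ∧ y ∈ U ∧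
    ∃ W, N.IsConcept W ∧ ((∀ m, m ∈ W ↔ m ∈ F U) ∧ x = d W))) ?_ (fun U hU hUX => ?_)
  · refine Dfn.exConcept 0 (((Dfn.all 2 ((Dfn.memVar 2 0).imp (Dfn.mem 2 hX))).and
      ((Dfn.memVar 1 0).and ?_)))
    exact Dfn.exConcept 1 ((Dfn.all 2 ((Dfn.memVar 2 1).iff (hF 2))).and (hd 0 1))
  · refine ⟨d (F U), fun y => ⟨?_, fun hy => ?_⟩⟩
    · rintro ⟨V, hV, hVX, hy, W, -, hWF, e⟩
      rw [Set.ext hWF] at e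
      rwa [hinj U V hU hV hUX hVX e]
    · exact ⟨U, hU, fun m hm => hUX hm, hy, F U, hN.isConcept_of_dfn (hF 0) hU, fun _ => Iff.rfl,
        rfl⟩

variable (hW : N.toFrame.WellBehaved)
include hW

/-- A permutation invariant relation holds of all generic pairs or of none. -/
theorem rel_iff_of_generic (hP : N.PermInvariant E) (hX : N.IsConcept X) (hXi : N.Infinite X)
    (hle : N.CardLe X Xᶜ) (hA : N.IsConcept A) (hB : N.IsConcept B) (hA' : N.IsConcept A')
    (hB' : N.IsConcept B') (h : N.Generic X A B) (h' : N.Generic X A' B') :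
    E A B ↔ E A' B' := by
  have hXc := hN.isConcept_compl hX
  have hXci := hN.infinite_mono hXi hle hXc
  have huniv : N.CardLe Set.univ Xᶜ := by
    rw [← Set.union_compl_self X]
    exact hN.union_cardLe hW hX hXc hXc hXci hle (hN.cardLe_of_subset hXc subset_rfl)
  have inner : ∀ C D : Set N.carrier, N.IsConcept C → C ⊆ D → N.CardLe D X → N.CardLe X C →
      N.CardEq X C := fun C D hC hCD hD hXC =>
    hN.cardEq_of_cardLe hW hX hC hXi hXC (hN.cardLe_trans (hN.cardLe_of_subset hC hCD) hD)
  have outer : ∀ C, N.IsConcept C → N.CardLe Xᶜ C → N.CardEq Xᶜ C := fun C hC hXC =>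
    hN.cardEq_of_cardLe hW hXc hC hXci hXC
      (hN.cardLe_trans (hN.cardLe_of_subset hC (Set.subset_univ C)) huniv)
  obtain ⟨π, hπ, rfl, rfl⟩ := hN.exists_perm_of_cells
    (hN.cardEq_trans (hN.cardEq_symm (inner _ A (hN.isConcept_inter hA hB)
      Set.inter_subset_left h.left_le h.le_inter)) (inner _ A' (hN.isConcept_inter hA' hB')
      Set.inter_subset_left h'.left_le h'.le_inter))
    (hN.cardEq_trans (hN.cardEq_symm (inner _ A (hN.isConcept_diff hA hB)
      Set.sdiff_subset h.left_le h.le_left)) (inner _ A' (hN.isConcept_diff hA' hB')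
      Set.sdiff_subset h'.left_le h'.le_left))
    (hN.cardEq_trans (hN.cardEq_symm (inner _ B (hN.isConcept_diff hB hA)
      Set.sdiff_subset h.right_le h.le_right)) (inner _ B' (hN.isConcept_diff hB' hA')
      Set.sdiff_subset h'.right_le h'.le_right))
    (hN.cardEq_trans (hN.cardEq_symm (outer _ (hN.isConcept_compl (hN.isConcept_union hA hB))
      h.le_outer)) (outer _ (hN.isConcept_compl (hN.isConcept_union hA' hB')) h'.le_outer))
  exact hP π hπ A B hA hB

/-- If generic pairs have distinct abstracts, `X` is not exponentially large: choose disjoint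
copies of `X` outside `X`, divide each into `|X|` fibres of size `|X|`, and attach to a subconcept
`U` of `X` the union of `X`, the fibres over `U` in the first copy, and the fibres over `X - U` in
the second. -/
theorem not_expl_of_generic (hd : N.DfnAbs d) (hX : N.IsConcept X) (hXi : N.Infinite X)
    (hle : N.CardLe X Xᶜ)
    (h : ∀ A B, N.IsConcept A → N.IsConcept B → N.Generic X A B → d A ≠ d B) : ¬ N.Expl X := by
  have hXc := hN.isConcept_compl hX
  obtain ⟨C₁, V₁, hC₁, hV₁, hd₁, e₁, ⟨g₁, hg₁, hb₁⟩, hXV₁⟩ :=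
    hN.exists_partition hW hX hXc hXi hle
  obtain ⟨C₂, V₂, hC₂, hV₂, hd₂, e₂, ⟨g₂, hg₂, hb₂⟩, hXV₂⟩ :=
    hN.exists_partition hW hX hV₁ hXi (hN.cardLe_trans hle hXV₁.cardLe)
  obtain ⟨p, hp, hpm, hfib⟩ := hN.exists_large_fibres hW hX hXi
  have sub₁ : C₁ ⊆ Xᶜ := Set.subset_union_left.trans_eq e₁
  have sub₁' : V₁ ⊆ Xᶜ := Set.subset_union_right.trans_eq e₁
  have sub₂ : C₂ ⊆ V₁ := Set.subset_union_left.trans_eq e₂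
  have sub₂' : V₂ ⊆ V₁ := Set.subset_union_right.trans_eq e₂
  have hXr := hN.cardLe_of_subset hX (subset_refl X)
  let F : Set N.carrier → Set N.carrier := fun U =>
    {z | z ∈ X ∨ (∃ w, (w ∈ X ∧ z = g₁ w) ∧ ∃ t, (w ∈ X ∧ t = p w) ∧ t ∈ U) ∨
      (∃ w, (w ∈ X ∧ z = g₂ w) ∧ ∃ t, (w ∈ X ∧ t = p w) ∧ ¬ t ∈ U)}
  have hF : ∀ i, N.Dfn (fun a A => a i ∈ F (Frame.ofRel (A 0 0))) := by
    intro i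
    refine (Dfn.mem i hX).or (Dfn.or ?_ ?_)
    · exact Dfn.ex (i + 1) ((Dfn.graph (i + 1) i hg₁).and
        (Dfn.ex (i + 2) ((Dfn.graph (i + 1) (i + 2) hp).and (Dfn.memVar (i + 2) 0))))
    · exact Dfn.ex (i + 1) ((Dfn.graph (i + 1) i hg₂).and
        (Dfn.ex (i + 2) ((Dfn.graph (i + 1) (i + 2) hp).and (Dfn.memVar (i + 2) 0).not)))
  have hXF : ∀ U, X ⊆ F U := fun U z hz => Or.inl hz
  have mem₁ : ∀ U, ∀ w ∈ X, (g₁ w ∈ F U ↔ p w ∈ U) := by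
    intro U w hw
    have hC := hb₁.mapsTo hw
    refine ⟨?_, fun h => Or.inr (Or.inl ⟨w, ⟨hw, rfl⟩, _, ⟨hw, rfl⟩, h⟩)⟩
    rintro (h | ⟨w', ⟨hw', e⟩, t, ⟨-, rfl⟩, h⟩ | ⟨w', ⟨hw', e⟩, -⟩)
    · exact absurd h (sub₁ hC)
    · rwa [hb₁.injOn hw hw' e]
    · exact absurd (sub₂ (e ▸ hb₂.mapsTo hw')) (Set.disjoint_left.1 hd₁ hC)
  have mem₂ : ∀ U, ∀ w ∈ X, (g₂ w ∈ F U ↔ p w ∉ U) := by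
    intro U w hw
    have hC := hb₂.mapsTo hw
    refine ⟨?_, fun h => Or.inr (Or.inr ⟨w, ⟨hw, rfl⟩, _, ⟨hw, rfl⟩, h⟩)⟩
    rintro (h | ⟨w', ⟨hw', e⟩, -⟩ | ⟨w', ⟨hw', e⟩, t, ⟨-, rfl⟩, h⟩)
    · exact absurd h (sub₁' (sub₂ hC))
    · exact absurd (sub₂ hC) (Set.disjoint_left.1 hd₁ (e ▸ hb₁.mapsTo hw'))
    · rwa [hb₂.injOn hw hw' e]
  have hFsub : ∀ U, F U ⊆ X ∪ (C₁ ∪ C₂) := by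
    rintro U z (h | ⟨w, ⟨hw, rfl⟩, -⟩ | ⟨w, ⟨hw, rfl⟩, -⟩)
    · exact Or.inl h
    · exact Or.inr (Or.inl (hb₁.mapsTo hw))
    · exact Or.inr (Or.inr (hb₂.mapsTo hw))
  have hbound : N.CardLe (X ∪ (C₁ ∪ C₂)) X :=
    hN.union_cardLe hW hX (hN.isConcept_union hC₁ hC₂) hX hXi hXr
      (hN.union_cardLe hW hC₁ hC₂ hX hXi (hN.cardEq_symm ⟨g₁, hg₁, hb₁⟩).cardLe
        (hN.cardEq_symm ⟨g₂, hg₂, hb₂⟩).cardLe)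
  have hFc : ∀ U, N.IsConcept U → N.IsConcept (F U) := fun U hU => hN.isConcept_of_dfn (hF 0) hU
  have hFle : ∀ U, N.IsConcept U → N.CardLe (F U) X := fun U hU =>
    hN.cardLe_trans (hN.cardLe_of_subset (hFc U hU) (hFsub U)) hbound
  have hgen : ∀ U V, N.IsConcept U → N.IsConcept V → (∃ x ∈ X, x ∈ U ∧ x ∉ V) →
      N.Generic X (F U) (F V) := by
    rintro U V hU hV ⟨x, hx, hxU, hxV⟩
    obtain ⟨W, hWc, hWX, hWx, hXW⟩ := hfib x hx
    have himg : ∀ {g D}, N.HasFun g X → Set.InjOn g X → (∀ w ∈ W, g w ∈ D) → N.CardLe X D :=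
      fun hg hi hD => hN.cardLe_trans hXW ⟨_, hN.hasFun_mono hg hWc hWX, hD, hi.mono hWX⟩
    refine ⟨hFle U hU, hFle V hV, hN.cardLe_of_subset hX fun z hz => ⟨hXF U hz, hXF V hz⟩,
      himg hg₁ hb₁.injOn fun w hw => ?_, himg hg₂ hb₂.injOn fun w hw => ?_, ?_⟩
    · rw [Set.mem_sdiff, mem₁ U w (hWX hw), mem₁ V w (hWX hw), hWx w hw]
      exact ⟨hxU, hxV⟩
    · rw [Set.mem_sdiff, mem₂ U w (hWX hw), mem₂ V w (hWX hw), hWx w hw]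
      exact ⟨hxV, not_not_intro hxU⟩
    · refine hN.cardLe_trans hXV₁.cardLe (hN.cardLe_trans hXV₂.cardLe
        (hN.cardLe_of_subset hV₂ fun z hz hz' => ?_))
      rcases Set.union_subset (hFsub U) (hFsub V) hz' with h | h | h
      · exact sub₁' (sub₂' hz) h
      · exact Set.disjoint_left.1 hd₁ h (sub₂' hz)
      · exact Set.disjoint_left.1 hd₂ h hz
  refine hN.not_expl_of_injOn hd hF hX fun U V hU hV hUX hVX e => ?_
  by_contra hne
  have : (∃ x ∈ X, x ∈ U ∧ x ∉ V) ∨ ∃ x ∈ X, x ∈ V ∧ x ∉ U := by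
    by_contra hcon
    push Not at hcon
    exact hne (Set.Subset.antisymm (fun x hx => hcon.1 x (hUX hx) hx)
      fun x hx => hcon.2 x (hVX hx) hx)
  rcases this with hUV | hVU
  · exact h _ _ (hFc U hU) (hFc V hV) (hgen U V hU hV hUV) e
  · exact h _ _ (hFc V hV) (hFc U hU) (hgen V U hV hU hVU) e.symm

/-- If generic pairs are equivalent, so are concepts with a large intersection and a large outer
cell: halves of these two cells make up a concept generic to both. -/
theorem rel_of_large_inter (hE : N.IsEquivOnConcepts E) (hX : N.IsConcept X)
    (hXi : N.Infinite X) (hle : N.CardLe X Xᶜ)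
    (hG : ∀ A B, N.IsConcept A → N.IsConcept B → N.Generic X A B → E A B)
    (hA : N.IsConcept A) (hB : N.IsConcept B) (hAX : N.CardLe A X) (hBX : N.CardLe B X)
    (hAB : N.CardLe X (A ∩ B)) (hout : N.CardLe Xᶜ (A ∪ B)ᶜ) : E A B := by
  have hXr := hN.cardLe_of_subset hX (subset_refl X)
  obtain ⟨P₁, P₂, hP₁, hP₂, hc₁, hc₂, hdP, hXP₁, hXP₂⟩ :=
    hN.exists_disjoint_subsets hW hX hXi hXr hAB
  obtain ⟨S₁, S₂, hS₁, hS₂, hs₁, hs₂, hdS, hXS₁, hXS₂⟩ :=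
    hN.exists_disjoint_subsets hW hX hXi hle hout
  have hZ := hN.isConcept_union hc₁ hs₁
  have hZX : N.CardLe (P₁ ∪ S₁) X := hN.union_cardLe hW hc₁ hs₁ hX hXi
    (hN.cardEq_symm hXP₁).cardLe (hN.cardEq_symm hXS₁).cardLe
  have gen : ∀ C, N.IsConcept C → N.CardLe C X → A ∩ B ⊆ C → C ⊆ A ∪ B →
      N.Generic X C (P₁ ∪ S₁) := by
    intro C hC hCX hsub hsup
    refine ⟨hCX, hZX, ?_, ?_, ?_, ?_⟩
    · exact hN.cardLe_trans hXP₁.cardLe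
        (hN.cardLe_of_subset hc₁ fun z hz => ⟨hsub (hP₁ hz), Or.inl hz⟩)
    · refine hN.cardLe_trans hXP₂.cardLe
        (hN.cardLe_of_subset hc₂ fun z hz => ⟨hsub (hP₂ hz), ?_⟩)
      rintro (h | h)
      · exact Set.disjoint_left.1 hdP h hz
      · exact hS₁ h (Or.inl (hP₂ hz).1)
    · exact hN.cardLe_trans hXS₁.cardLe
        (hN.cardLe_of_subset hs₁ fun z hz => ⟨Or.inr hz, fun h => hS₁ hz (hsup h)⟩)
    · refine hN.cardLe_trans hXS₂.cardLe (hN.cardLe_of_subset hs₂ fun z hz => ?_)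
      rintro (h | h | h)
      · exact hS₂ hz (hsup h)
      · exact hS₂ hz (Or.inl (hP₁ h).1)
      · exact Set.disjoint_left.1 hdS h hz
  exact hE.trans A _ B hA hZ hB
    (hG _ _ hA hZ (gen A hA hAX Set.inter_subset_left Set.subset_union_left))
    (hE.symm B _ hB hZ (hG _ _ hB hZ (gen B hB hBX Set.inter_subset_right Set.subset_union_right)))

/-- If generic pairs are equivalent, so are all concepts bicardinally equivalent to `X`. -/
theorem rel_of_generic (hu : N.Infinite Set.univ) (hE : N.IsEquivOnConcepts E)
    (hX : N.IsConcept X) (hT : N.Top X) (hle : N.CardLe X Xᶜ)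
    (hG : ∀ A B, N.IsConcept A → N.IsConcept B → N.Generic X A B → E A B)
    (hY : N.IsConcept Y) (hXY : N.Bicard X Y) : E X Y := by
  have hXc := hN.isConcept_compl hX
  have hYc := hN.isConcept_compl hY
  have hXi := hN.infinite_of_expl hW hu hX hT.1
  have hXr := hN.cardLe_of_subset hX (subset_refl X)
  have hYX : N.CardLe Y X := (hN.cardEq_symm hXY.1).cardLe
  have hXYle : N.CardLe X Y := hXY.1.cardLe
  have hXcY : N.CardLe Xᶜ Yᶜ := hXY.2.cardLe
  have rel := fun {A B : Set N.carrier} (hA : N.IsConcept A) (hB : N.IsConcept B) =>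
    hN.rel_of_large_inter hW hE hX hXi hle hG hA hB
  by_cases hXcX : N.CardLe Xᶜ X
  · -- `X`, `Y` and their complements have the same size, so one of the two diagonals of the Venn
    -- diagram of `X` and `Y` consists of large cells
    have hYcX : N.CardLe Yᶜ X := hN.cardLe_trans (hN.cardEq_symm hXY.2).cardLe hXcX
    have hP := hN.isConcept_inter hX hY
    have hQ := hN.isConcept_diff hX hY
    have hR := hN.isConcept_diff hY hX
    have hS := hN.isConcept_compl (hN.isConcept_union hX hY)
    have half := fun {P Q : Set N.carrier} (hP : N.IsConcept P) (hQ : N.IsConcept Q) =>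
      hN.cardLe_or_of_expl hW hu hP hQ hT.1
    have h₁ : N.CardLe X (X ∩ Y) ∨ N.CardLe X (X \ Y) :=
      half hP hQ (by rwa [Set.inter_union_sdiff])
    have h₂ : N.CardLe X (Y \ X) ∨ N.CardLe X (X ∪ Y)ᶜ := half hR hS
      (by rwa [show Y \ X ∪ (X ∪ Y)ᶜ = Xᶜ by ext x; simp; tauto])
    have h₃ : N.CardLe X (X ∩ Y) ∨ N.CardLe X (Y \ X) := half hP hR
      (by rwa [Set.inter_comm, Set.inter_union_sdiff])
    have h₄ : N.CardLe X (X \ Y) ∨ N.CardLe X (X ∪ Y)ᶜ := half hQ hS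
      (by rw [show X \ Y ∪ (X ∪ Y)ᶜ = Yᶜ by ext x; simp; tauto]
          exact hN.cardLe_trans hle hXcY)
    have h₅ : N.CardLe X (X ∩ Y) ∧ N.CardLe X (X ∪ Y)ᶜ ∨
        N.CardLe X (X \ Y) ∧ N.CardLe X (Y \ X) := by tauto
    rcases h₅ with ⟨h, h'⟩ | ⟨h, h'⟩
    · exact rel hX hY hXr hYX h (hN.cardLe_trans hXcX h')
    · have hXYc : E X Yᶜ := rel hX hYc hXr hYcX h (hN.cardLe_trans hXcX
        (by rwa [show (X ∪ Yᶜ)ᶜ = Y \ X by ext x; simp; tauto]))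
      obtain ⟨P₁, P₂, hP₁, hP₂, hc₁, hc₂, hdP, hXP₁, hXP₂⟩ :=
        hN.exists_disjoint_subsets hW hX hXi hXr hXYle
      obtain ⟨S₁, S₂, hS₁, hS₂, hs₁, hs₂, hdS, hXS₁, hXS₂⟩ :=
        hN.exists_disjoint_subsets hW hX hXi hXr (hN.cardLe_trans hle hXcY)
      have hZ := hN.isConcept_union hc₁ hs₁
      have hZX : N.CardLe (P₁ ∪ S₁) X := hN.union_cardLe hW hc₁ hs₁ hX hXi
        (hN.cardEq_symm hXP₁).cardLe (hN.cardEq_symm hXS₁).cardLe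
      have hYZ : E Y (P₁ ∪ S₁) := by
        refine rel hY hZ hYX hZX ?_ (hN.cardLe_trans hXcX ?_)
        · exact hN.cardLe_trans hXP₁.cardLe
            (hN.cardLe_of_subset hc₁ fun z hz => ⟨hP₁ hz, Or.inl hz⟩)
        · refine hN.cardLe_trans hXS₂.cardLe (hN.cardLe_of_subset hs₂ fun z hz => ?_)
          rintro (h | h | h)
          · exact hS₂ hz h
          · exact hS₂ hz (hP₁ h)
          · exact Set.disjoint_left.1 hdS h hz
      have hZY : E (P₁ ∪ S₁) Yᶜ := by
        refine rel hZ hYc hZX hYcX ?_ (hN.cardLe_trans hXcX ?_)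
        · exact hN.cardLe_trans hXS₁.cardLe
            (hN.cardLe_of_subset hs₁ fun z hz => ⟨Or.inr hz, hS₁ hz⟩)
        · refine hN.cardLe_trans hXP₂.cardLe (hN.cardLe_of_subset hc₂ fun z hz => ?_)
          rintro ((h | h) | h)
          · exact Set.disjoint_left.1 hdP h hz
          · exact hS₁ h (hP₂ hz)
          · exact h (hP₂ hz)
      exact hE.trans _ _ _ hX hYc hY hXYc
        (hE.symm _ _ hY hYc (hE.trans _ _ _ hY hZ hYc hYZ hZY))
  · -- `X ∪ Y` is still smaller than its complement, and it includes both `X` and `Y`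
    have hZ := hN.isConcept_union hX hY
    have hZX : N.CardLe (X ∪ Y) X := hN.union_cardLe hW hX hY hX hXi hXr hYX
    have hout : N.CardLe Xᶜ (X ∪ Y)ᶜ := by
      refine (hN.cardLe_or_of_expl hW hu hZ (hN.isConcept_compl hZ) hT.2 ?_).resolve_left
        fun h => hXcX (hN.cardLe_trans h hZX)
      rw [Set.union_compl_self]
      exact hN.cardLe_of_subset hXc (Set.subset_univ _)
    refine hE.trans _ _ _ hX hZ hY ?_ (hE.symm _ _ hY hZ ?_)
    · exact rel hX hZ hXr hZX (hN.cardLe_of_subset hX fun z hz => ⟨hz, Or.inl hz⟩)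
        (by rwa [← Set.union_assoc, Set.union_self])
    · exact rel hY hZ hYX hZX (hN.cardLe_trans hXYle
        (hN.cardLe_of_subset hY fun z hz => ⟨hz, Or.inr hz⟩))
        (by rwa [Set.union_comm X Y, ← Set.union_assoc, Set.union_self, Set.union_comm Y X])

/-- In a model with infinitely many objects, `E` relates bicardinally equivalent TOP concepts that
are at most as large as their complements. -/
theorem rel_of_infinite (hu : N.Infinite Set.univ) (hd : N.DfnAbs d)
    (hdE : ∀ A B, N.IsConcept A → N.IsConcept B → (d A = d B ↔ E A B))
    (hE : N.IsEquivOnConcepts E) (hP : N.PermInvariant E) (hX : N.IsConcept X)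
    (hT : N.Top X) (hle : N.CardLe X Xᶜ) (hY : N.IsConcept Y) (hXY : N.Bicard X Y) : E X Y := by
  have hXi := hN.infinite_of_expl hW hu hX hT.1
  refine hN.rel_of_generic hW hu hE hX hT hle (fun A B hA hB hAB => ?_) hY hXY
  by_contra hne
  refine hN.not_expl_of_generic hW hd hX hXi hle (fun A' B' hA' hB' hAB' e => hne ?_) hT.1
  exact (hN.rel_iff_of_generic hW hP hX hXi hle hA hB hA' hB' hAB hAB').2
    ((hdE A' B' hA' hB').1 e)

end Comprehension

end Structure

/-! ### Models with Dedekind-finitely many objects -/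

theorem swap_image_eq {α : Type*} [DecidableEq α] {A : Set α} {b a : α} (hb : b ∈ A)
    (ha : a ∉ A) : Equiv.swap b a '' A = insert a (A \ {b}) := by
  ext z
  rw [Equiv.image_eq_preimage_symm, Equiv.symm_swap, Set.mem_preimage, Set.mem_insert_iff,
    Set.mem_sdiff, Set.mem_singleton_iff]
  by_cases hzb : z = b
  · subst hzb
    have : z ≠ a := fun h => ha (h ▸ hb)
    simp [ha, this]
  · by_cases hza : z = a
    · subst hza; simp [hb]
    · rw [Equiv.swap_apply_of_ne_of_ne hzb hza]; tauto

theorem swap_image_eq_self {α : Type*} [DecidableEq α] {A : Set α} {b a : α} (h : b ∈ A ↔ a ∈ A) :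
    Equiv.swap b a '' A = A := by
  ext z
  rw [Equiv.image_eq_preimage_symm, Equiv.symm_swap, Set.mem_preimage]
  by_cases hzb : z = b
  · subst hzb; simp [h]
  · by_cases hza : z = a
    · subst hza; simp [h]
    · rw [Equiv.swap_apply_of_ne_of_ne hzb hza]

/-- `R` enumerates an increasing chain of subsets of `Z`, each obtained from its predecessor by
adding one element, with `Z` as last member; the member `R[u]` is the one at which `u` is added.
The second-order clause makes induction along the chain available for concepts. -/
structure Frame.IsChain (M : Frame.{u}) (Z : Set M.carrier) (R : Set (Fin 2 → M.carrier)) :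
    Prop where
  sub : ∀ u, u ∈ Z → ∀ m, ![u, m] ∈ R → m ∈ Z
  last : (∃ z, z ∈ Z) → ∃ t, t ∈ Z ∧ ∀ m, (![t, m] ∈ R ↔ m ∈ Z)
  step : ∀ U, M.IsConcept U → (∃ x, x ∈ U ∧ x ∈ Z) → ∃ u, (u ∈ U ∧ u ∈ Z) ∧
    ((∀ m, (![u, m] ∈ R ↔ m = u)) ∨
      ∃ v, (v ∈ Z ∧ v ∉ U) ∧ (![v, u] ∉ R ∧ ∀ m, (![u, m] ∈ R ↔ m = u ∨ ![v, m] ∈ R)))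

/-- Having a chain is expressible in the pure language. -/
theorem Frame.dfn_isChain (M : Frame.{u}) :
    M.toPure.Dfn (fun _ A => ∃ R ∈ M.Rel 1, M.IsChain (ofRel (A 0 0)) R) := by
  have h : M.toPure.Dfn (fun _ A => ∃ R ∈ M.toPure.Rel 1,
      ((∀ u, u ∈ ofRel (A 0 0) → ∀ m, ![u, m] ∈ R → m ∈ ofRel (A 0 0)) ∧
      ((∃ z, z ∈ ofRel (A 0 0)) →
        ∃ t, t ∈ ofRel (A 0 0) ∧ ∀ m, (![t, m] ∈ R ↔ m ∈ ofRel (A 0 0)))) ∧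
      ∀ U, M.toPure.IsConcept U → (∃ x, x ∈ U ∧ x ∈ ofRel (A 0 0)) →
        ∃ u, (u ∈ U ∧ u ∈ ofRel (A 0 0)) ∧ ((∀ m, (![u, m] ∈ R ↔ m = u)) ∨
        ∃ v, (v ∈ ofRel (A 0 0) ∧ v ∉ U) ∧
          (![v, u] ∉ R ∧ ∀ m, (![u, m] ∈ R ↔ m = u ∨ ![v, m] ∈ R)))) := by
    refine Structure.Dfn.exRel 1 0 (Structure.Dfn.and (Structure.Dfn.and ?_ ?_) ?_)
    · exact Structure.Dfn.all 0 ((Structure.Dfn.memVar 0 0).imp (Structure.Dfn.all 1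
        ((Structure.Dfn.pairVar 0 1 0).imp (Structure.Dfn.memVar 1 0))))
    · exact (Structure.Dfn.ex 0 (Structure.Dfn.memVar 0 0)).imp (Structure.Dfn.ex 0
        ((Structure.Dfn.memVar 0 0).and (Structure.Dfn.all 1
        ((Structure.Dfn.pairVar 0 1 0).iff (Structure.Dfn.memVar 1 0)))))
    · refine Structure.Dfn.allConcept 1 ((Structure.Dfn.ex 0 ((Structure.Dfn.memVar 0 1).and
        (Structure.Dfn.memVar 0 0))).imp (Structure.Dfn.ex 0 (((Structure.Dfn.memVar 0 1).and
        (Structure.Dfn.memVar 0 0)).and (Structure.Dfn.or ?_ ?_))))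
      · exact Structure.Dfn.all 1 ((Structure.Dfn.pairVar 0 1 0).iff (Structure.Dfn.eq 1 0))
      · exact Structure.Dfn.ex 1 (((Structure.Dfn.memVar 1 0).and (Structure.Dfn.memVar 1 1).not).and
          ((Structure.Dfn.pairVar 1 0 0).not.and (Structure.Dfn.all 2
          ((Structure.Dfn.pairVar 0 2 0).iff ((Structure.Dfn.eq 2 0).or
            (Structure.Dfn.pairVar 1 2 0))))))
  refine h.congr fun a A _ => exists_congr fun R => and_congr_right fun _ => ?_
  exact ⟨fun h => ⟨⟨h.1, h.2⟩, h.3⟩, fun h => ⟨h.1.1, h.1.2, h.2⟩⟩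

namespace Structure.Comprehension

variable {L : Signature.{v}} {N : Structure.{u, v} L} (hN : N.Comprehension)
  {X Y Z : Set N.carrier} {E : Set N.carrier → Set N.carrier → Prop}
  {d : Set N.carrier → N.carrier}
include hN

theorem exists_ne_of_expl (hX : N.Expl X) (hXc : N.Expl Xᶜ) :
    ∃ a b, a ∈ X ∧ b ∈ X ∧ a ≠ b := by
  obtain ⟨c, hc⟩ : Xᶜ.Nonempty :=
    Set.nonempty_iff_ne_empty.2 fun h => hN.not_expl_empty (h ▸ hXc)
  obtain ⟨a, ha⟩ : X.Nonempty := Set.nonempty_iff_ne_empty.2 fun h => hN.not_expl_empty (h ▸ hX)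
  by_contra hne
  push Not at hne
  have : X = {a} := Set.eq_singleton_iff_unique_mem.2 ⟨ha, fun b hb => (hne a b ha hb).symm⟩
  have hca : c ≠ a := fun h => hc (h ▸ ha)
  exact hN.not_expl_singleton hca (this ▸ hX)

/-- A TOP concept has three elements and its complement has two. -/
theorem exists_distinct_of_top (hT : N.Top X) :
    (∀ b b', ∃ c ∈ X, c ≠ b ∧ c ≠ b') ∧ (∃ b b', b ∈ X ∧ b' ∈ X ∧ b ≠ b') ∧
      ∃ a a', a ∉ X ∧ a' ∉ X ∧ a ≠ a' := by
  obtain ⟨b, b', hb, hb', hbb⟩ := hN.exists_ne_of_expl hT.1 hT.2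
  obtain ⟨a, a', ha, ha', haa⟩ := hN.exists_ne_of_expl hT.2 ((compl_compl X).symm ▸ hT.1)
  refine ⟨fun x y => ?_, ⟨b, b', hb, hb', hbb⟩, a, a', ha, ha', haa⟩
  obtain ⟨c, hc, hcb, hcb'⟩ : ∃ c ∈ X, c ≠ b ∧ c ≠ b' := by
    by_contra hne
    push Not at hne
    have ne : ∀ {p q}, p ∈ X → q ∉ X → p ≠ q := fun hp hq h => hq (h ▸ hp)
    have : X = {b, b'} := by
      ext z
      refine ⟨fun hz => ?_, ?_⟩
      · by_cases h : z = b
        · exact Or.inl h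
        · exact Or.inr (hne z hz h)
      · rintro (rfl | rfl) <;> assumption
    exact hN.not_expl_pair (ne hb ha) (ne hb ha') (ne hb' ha) (ne hb' ha') haa hbb (this ▸ hT.1)
  by_contra hne
  push Not at hne
  have h1 := hne b hb
  have h2 := hne b' hb'
  have h3 := hne c hc
  rcases eq_or_ne b x with e | e
  · exact hcb' ((h3 (e ▸ hcb)).trans (h2 (e ▸ hbb.symm)).symm)
  · rcases eq_or_ne b' x with e' | e'
    · exact hcb ((h3 (e' ▸ hcb')).trans (h1 e).symm)
    · exact hbb ((h1 e).trans (h2 e').symm)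

open Classical in
theorem hasFun_swap (a b : N.carrier) : N.HasFun (Equiv.swap a b) Set.univ := by
  refine hN.hasFun ((((Dfn.eqConst 0 a).and (Dfn.eqConst 1 b)).or
    (((Dfn.eqConst 0 b).and (Dfn.eqConst 1 a)).or
      (((Dfn.eqConst 0 a).not.and (Dfn.eqConst 0 b).not).and (Dfn.eq 1 0)))).congr
        fun s _ _ => ?_)
  rcases eq_or_ne a b with rfl | hab
  · by_cases ha : s 0 = a <;> simp [ha]
  · by_cases ha : s 0 = a
    · simp [ha, hab]
    · by_cases hb : s 0 = b
      · simp [hb, hab.symm]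
      · simp [ha, hb, Equiv.swap_apply_of_ne_of_ne]

theorem hasFun_perm_mul {π σ : Equiv.Perm N.carrier} (hπ : N.HasFun π Set.univ)
    (hσ : N.HasFun σ Set.univ) : N.HasFun (π * σ : Equiv.Perm N.carrier) Set.univ :=
  hN.hasFun_comp (f := σ) (g := π) hσ hπ (Set.mapsTo_univ _ _)

theorem isConcept_perm {π : Equiv.Perm N.carrier} (hπ : N.HasFun π Set.univ)
    (hX : N.IsConcept X) : N.IsConcept (π '' X) :=
  hN.isConcept_image (hN.hasFun_mono hπ hX (Set.subset_univ X))

theorem bicard_perm {π : Equiv.Perm N.carrier} (hπ : N.HasFun π Set.univ)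
    (hX : N.IsConcept X) : N.Bicard X (π '' X) := by
  refine ⟨Frame.cardEq_image (hN.hasFun_mono hπ hX (Set.subset_univ X)) π.injective.injOn, ?_⟩
  rw [← Set.image_compl_eq π.bijective]
  exact Frame.cardEq_image (hN.hasFun_mono hπ (hN.isConcept_compl hX) (Set.subset_univ _))
    π.injective.injOn

theorem bicard_trans (h₁ : N.Bicard X Y) (h₂ : N.Bicard Y Z) : N.Bicard X Z :=
  ⟨hN.cardEq_trans h₁.1 h₂.1, hN.cardEq_trans h₁.2 h₂.2⟩

theorem bicard_symm (h : N.Bicard X Y) : N.Bicard Y X :=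
  ⟨hN.cardEq_symm h.1, hN.cardEq_symm h.2⟩

open Classical in
/-- If some concept is equivalent to the result of exchanging one element for another, then so are
all concepts bicardinally equivalent to it, for all exchanges. -/
theorem rel_swap (hP : N.PermInvariant E) (hX : N.IsConcept X) (hXY : N.Bicard X Y)
    {b a b' a' : N.carrier} (hb : b ∈ X) (ha : a ∉ X) (hb' : b' ∈ Y) (ha' : a' ∉ Y)
    (h : E X (Equiv.swap b a '' X)) : E Y (Equiv.swap b' a' '' Y) := by
  obtain ⟨⟨f, hf, hfb⟩, g, hg, hgb⟩ := hXY
  obtain ⟨π, hπ, ef, eg⟩ := hN.exists_perm hf hfb hg hgb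
  have hπX : π '' X = Y := by rw [ef.image_eq, hfb.image_eq]
  have hπb : π b ∈ Y := hπX ▸ ⟨b, hb, rfl⟩
  have hπa : π a ∉ Y := by
    rw [← hπX]
    rintro ⟨x, hx, e⟩
    exact ha (π.injective e ▸ hx)
  -- correct `π` by exchanges within `Y` and within its complement
  let σ : Equiv.Perm N.carrier := Equiv.swap (π b) b' * (Equiv.swap (π a) a' * π)
  have hσ : N.HasFun σ Set.univ :=
    hN.hasFun_perm_mul (hN.hasFun_swap _ _) (hN.hasFun_perm_mul (hN.hasFun_swap _ _) hπ)
  have ne : ∀ {p q}, p ∈ Y → q ∉ Y → p ≠ q := fun hp hq h => hq (h ▸ hp)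
  have hσb : σ b = b' := by
    show Equiv.swap (π b) b' (Equiv.swap (π a) a' (π b)) = b'
    rw [Equiv.swap_apply_of_ne_of_ne (ne hπb hπa) (ne hπb ha'), Equiv.swap_apply_left]
  have hσa : σ a = a' := by
    show Equiv.swap (π b) b' (Equiv.swap (π a) a' (π a)) = a'
    rw [Equiv.swap_apply_left,
      Equiv.swap_apply_of_ne_of_ne (ne hπb ha').symm (ne hb' ha').symm]
  have hσX : σ '' X = Y := by
    show (Equiv.swap (π b) b' ∘ Equiv.swap (π a) a' ∘ π) '' X = Y
    rw [Set.image_comp, Set.image_comp, hπX,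
      swap_image_eq_self (b := π a) (a := a') (by simp [hπa, ha']),
      swap_image_eq_self (by simp [hπb, hb'])]
  have hswap : σ '' (Equiv.swap b a '' X) = Equiv.swap b' a' '' Y := by
    rw [← hσX, ← hσb, ← hσa, ← Set.image_comp, ← Set.image_comp]
    congr 1
    funext x
    exact DFunLike.congr_fun (Equiv.mul_swap_eq_swap_mul σ b a) x
  have := (hP σ hσ X _ hX (hN.isConcept_perm (hN.hasFun_swap b a) hX)).1 h
  rwa [hσX, hswap] at this

/-- Cancellation: `|X| = |Y|` implies `|X - Y| = |Y - X|`. -/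
theorem cardEq_diff (hW : N.toFrame.WellBehaved) (hu : ¬ N.Infinite Set.univ)
    (hX : N.IsConcept X) (hY : N.IsConcept Y) (h : N.CardEq X Y) :
    N.CardEq (X \ Y) (Y \ X) := by
  have key : ∀ {A B : Set N.carrier}, N.IsConcept A → N.IsConcept B → N.CardEq A B →
      N.CardLe (A \ B) (B \ A) → N.CardEq (A \ B) (B \ A) := by
    intro A B hA hB hAB hle
    obtain ⟨U, hU, hUc, hAU⟩ := hN.exists_subset_of_cardLe hle
    rcases hU.eq_or_ssubset with rfl | hss
    · exact hAU
    · exfalso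
      have hI := hN.isConcept_inter hA hB
      obtain ⟨x, hx, hxU⟩ := Set.exists_of_ssubset hss
      have hle' : N.CardLe A (A ∩ B ∪ U) := by
        have := hN.cardLe_union (hN.cardLe_of_subset hI subset_rfl) hAU.cardLe
          (Set.disjoint_left.2 fun z hz hz' => hz'.2 hz.2)
          (Set.disjoint_left.2 fun z hz hz' => (hU hz').2 hz.1)
        rwa [Set.inter_union_sdiff] at this
      refine hu (hN.infinite_mono (X := B) ⟨A ∩ B ∪ U, hN.isConcept_union hI hUc, ⟨?_, ?_⟩,
        hN.cardLe_trans (hN.cardEq_symm hAB).cardLe hle'⟩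
        (hN.cardLe_of_subset hB (Set.subset_univ B)) hN.isConcept_univ)
      · exact Set.union_subset Set.inter_subset_right (hU.trans Set.sdiff_subset)
      · intro hsup
        rcases hsup hx.1 with h | h
        · exact hx.2 h.1
        · exact hxU h
  rcases hW.comparability _ _ (hN.isConcept_diff hX hY) (hN.isConcept_diff hY hX) with hle | hle
  · exact key hX hY h hle
  · exact hN.cardEq_symm (key hY hX (hN.cardEq_symm h) hle)

/-- Dedekind-finite concepts have chains: a concept of least size without a chain could not lose
an element without losing size. -/
theorem exists_isChain (hW : N.toFrame.WellBehaved) (hu : ¬ N.Infinite Set.univ)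
    (hZ : N.IsConcept Z) : ∃ R ∈ N.Rel 1, N.IsChain Z R := by
  by_contra hno
  obtain ⟨W, hWc, hWn, hmin⟩ := exists_cardLe_minimal hW.wellFounded
    (P := fun Z => ¬ ∃ R ∈ N.Rel 1, N.IsChain Z R) N.toFrame.dfn_isChain.not hZ hno
  by_cases hne : ∃ c, c ∈ W
  swap
  · obtain ⟨R, hR⟩ := N.rel_nonempty 1
    push Not at hne
    exact hWn ⟨R, hR, fun u hu => absurd hu (hne u), fun ⟨z, hz⟩ => absurd hz (hne z),
      fun U _ ⟨x, _, hx⟩ => absurd hx (hne x)⟩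
  obtain ⟨c, hc⟩ := hne
  have hd := hN.isConcept_diff hWc (hN.isConcept_singleton c)
  have hex : ∃ R ∈ N.Rel 1, N.IsChain (W \ {c}) R := by
    by_contra hno'
    exact hu (hN.infinite_mono (X := W) ⟨W \ {c}, hd, ⟨Set.sdiff_subset, fun h => (h hc).2 rfl⟩,
      hmin _ hd hno'⟩ (hN.cardLe_of_subset hWc (Set.subset_univ W)) hN.isConcept_univ)
  obtain ⟨R, hR, hch⟩ := hex
  -- `c` is put on top of a chain for `W - {c}`
  refine hWn ⟨_, hN.mem_rel_one (Q := fun x y => (x ≠ c ∧ ![x, y] ∈ R) ∨ (x = c ∧ y ∈ W))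
    (((Dfn.eqConst 0 c).not.and (Dfn.pair 0 1 hR)).or ((Dfn.eqConst 0 c).and (Dfn.mem 1 hWc))),
    ?_⟩
  have top : ∀ m, (((c ≠ c ∧ ![c, m] ∈ R) ∨ (c = c ∧ m ∈ W)) ↔ m ∈ W) := fun m => by simp
  have low : ∀ {x}, x ≠ c → ∀ m, (((x ≠ c ∧ ![x, m] ∈ R) ∨ (x = c ∧ m ∈ W)) ↔ ![x, m] ∈ R) :=
    fun hx m => by simp [hx]
  refine ⟨fun u hu m hm => ?_, fun _ => ⟨c, hc, top⟩, fun U hU hUW => ?_⟩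
  · rcases hm with ⟨hu', hm⟩ | ⟨-, hm⟩
    · exact (hch.sub u ⟨hu, hu'⟩ m hm).1
    · exact hm
  · by_cases hU' : ∃ x, x ∈ U ∧ x ∈ W \ {c}
    · obtain ⟨u, ⟨huU, huW⟩, h | ⟨v, ⟨hv, hvU⟩, hvu, h⟩⟩ := hch.step U hU hU'
      · exact ⟨u, ⟨huU, huW.1⟩, Or.inl fun m => (low huW.2 m).trans (h m)⟩
      · exact ⟨u, ⟨huU, huW.1⟩, Or.inr ⟨v, ⟨hv.1, hvU⟩, fun h' => hvu ((low hv.2 u).1 h'),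
          fun m => (low huW.2 m).trans ((h m).trans (or_congr_right (low hv.2 m).symm))⟩⟩
    · push Not at hU'
      have hcU : c ∈ U := by
        obtain ⟨x, hxU, hxW⟩ := hUW
        by_contra hcU
        exact hU' x hxU ⟨hxW, fun h => hcU (h ▸ hxU)⟩
      refine ⟨c, ⟨hcU, hc⟩, ?_⟩
      by_cases hne : ∃ z, z ∈ W \ {c}
      · obtain ⟨t, ht, htop⟩ := hch.last hne
        refine Or.inr ⟨t, ⟨ht.1, fun h => hU' t h ht⟩, fun h' => ?_, fun m => ?_⟩
        · exact ((htop c).1 ((low ht.2 c).1 h')).2 rfl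
        · refine (top m).trans (Iff.trans ?_ (or_congr_right ((low ht.2 m).trans (htop m)).symm))
          by_cases hm : m = c
          · simp [hm, hc]
          · simp [hm]
      · push Not at hne
        refine Or.inl fun m => (top m).trans ⟨fun hm => ?_, fun hm => hm ▸ hc⟩
        by_contra hmc
        exact hne m ⟨hm, hmc⟩

end Structure.Comprehension

namespace Structure.Comprehension

variable {L : Signature.{v}} {N : Structure.{u, v} L} (hN : N.Comprehension)
  {X Y Z : Set N.carrier} {E : Set N.carrier → Set N.carrier → Prop}
  {d : Set N.carrier → N.carrier}
include hN

open Classical in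
/-- If exchanging one element for another leads to an equivalent concept, all concepts
bicardinally equivalent to `X` are equivalent: elements of `X - Y` are exchanged for elements of
`Y - X` one at a time, along a chain for `X - Y`. -/
theorem rel_of_swap (hW : N.toFrame.WellBehaved) (hu : ¬ N.Infinite Set.univ)
    (hd : N.DfnAbs d) (hdE : ∀ A B, N.IsConcept A → N.IsConcept B → (d A = d B ↔ E A B))
    (hE : N.IsEquivOnConcepts E)
    (hX : N.IsConcept X) (hY : N.IsConcept Y) (hXY : N.Bicard X Y)
    (hs : ∀ A, N.IsConcept A → N.Bicard X A → ∀ b ∈ A, ∀ a ∉ A, E A (Equiv.swap b a '' A)) :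
    E X Y := by
  have hD := hN.isConcept_diff hX hY
  obtain ⟨f, hf, hfb⟩ := hN.cardEq_diff hW hu hX hY hXY.1
  obtain ⟨R, hR, hch⟩ := hN.exists_isChain hW hu hD
  -- `G S` is the result of exchanging the elements of `S` for their images under `f`
  let G : Set N.carrier → Set N.carrier := fun S => {z | (z ∈ X ∧ z ∉ S) ∨ z ∈ f '' S}
  have hGX : ∀ S, N.IsConcept S → S ⊆ X \ Y → N.IsConcept (G S) ∧ N.Bicard X (G S) := by
    intro S hS hSD
    have hfS := hN.hasFun_mono hf hS hSD
    have hSi : N.CardEq S (f '' S) := Frame.cardEq_image hfS (hfb.injOn.mono hSD)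
    have hi := hN.isConcept_image hfS
    have hiD : f '' S ⊆ Y \ X := (Set.image_mono hSD).trans hfb.image_eq.subset
    have hr := hN.isConcept_diff hX hS
    have hr' := hN.isConcept_diff (hN.isConcept_compl hX) hi
    refine ⟨hN.isConcept_union hr hi, ?_, ?_⟩
    · have := hN.cardEq_union (hN.cardEq_refl hr) hSi disjoint_sdiff_self_left
        (Set.disjoint_left.2 fun z hz hz' => (hiD hz').2 hz.1)
      rwa [Set.sdiff_union_of_subset fun z hz => (hSD hz).1] at this
    · have := hN.cardEq_union (hN.cardEq_refl hr') (hN.cardEq_symm hSi) disjoint_sdiff_self_left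
        (Set.disjoint_left.2 fun z hz hz' => hz.1 (hSD hz').1)
      rw [Set.sdiff_union_of_subset (show f '' S ⊆ Xᶜ from fun z hz => (hiD hz).2)] at this
      convert this using 1
      ext z
      have h1 : z ∈ S → z ∈ X := fun hz => (hSD hz).1
      have h2 : z ∈ f '' S → z ∉ X := fun hz => (hiD hz).2
      show ¬ ((z ∈ X ∧ z ∉ S) ∨ z ∈ f '' S) ↔ (¬ z ∈ X ∧ ¬ z ∈ f '' S) ∨ z ∈ S
      tauto
  have step : ∀ S u, N.IsConcept S → S ⊆ X \ Y → u ∈ X \ Y → u ∉ S →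
      E (G S) (G (insert u S)) := by
    intro S u hS hSD hu' huS
    have hfu : f u ∈ Y \ X := hfb.mapsTo hu'
    have hb : u ∈ G S := Or.inl ⟨hu'.1, huS⟩
    have ha : f u ∉ G S := by
      rintro (⟨h, -⟩ | ⟨s, hs, e⟩)
      · exact hfu.2 h
      · exact huS (hfb.injOn (hSD hs) hu' e ▸ hs)
    have e : G (insert u S) = Equiv.swap u (f u) '' G S := by
      rw [swap_image_eq hb ha]
      ext z
      have h1 : z = f u → z ∉ X := fun h => h ▸ hfu.2
      have h2 : z ∈ f '' S → z ≠ u := by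
        rintro ⟨s, hs, rfl⟩ h
        exact (hfb.mapsTo (hSD hs)).2 (h ▸ hu'.1)
      show (z ∈ X ∧ z ∉ insert u S) ∨ z ∈ f '' insert u S ↔
        z = f u ∨ (((z ∈ X ∧ z ∉ S) ∨ z ∈ f '' S) ∧ z ≠ u)
      rw [Set.image_insert_eq, Set.mem_insert_iff, Set.mem_insert_iff]
      tauto
    rw [e]
    exact hs (G S) (hGX S hS hSD).1 (hGX S hS hSD).2 u hb (f u) ha
  let sec : N.carrier → Set N.carrier := fun x => {m | ![x, m] ∈ R}
  have hsec : ∀ x, N.IsConcept (sec x) := fun x =>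
    hN.isConcept (Q := fun m => ![x, m] ∈ R) ((Dfn.ex 1 (Q := fun a _ y => y = x ∧ ![y, a 0] ∈ R)
      ((Dfn.eqConst 1 x).and (Dfn.pair 1 0 hR))).congr fun a _ _ => by simp)
  have hG0 : G ∅ = X := by ext z; simp [G]
  -- the stages of the exchange at which the result is not equivalent to `X` form a concept
  have hbad : N.IsConcept {x | x ∈ X \ Y ∧ ¬ E X (G (sec x))} := by
    refine hN.isConcept (Q := fun x => x ∈ X \ Y ∧ ¬ E X (G (sec x)))
      (((Dfn.mem 0 hD).and (Dfn.exConcept 0 (Q := fun a _ W =>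
        (∀ m, m ∈ W ↔ (m ∈ X ∧ ¬ ![a 0, m] ∈ R) ∨ ∃ s, (s ∈ X \ Y ∧ m = f s) ∧ ![a 0, s] ∈ R) ∧
          ∃ x, x = d X ∧ x = d W) ((Dfn.all 1 ((Dfn.memVar 1 0).iff
            (((Dfn.mem 1 hX).and (Dfn.pair 0 1 hR).not).or (Dfn.ex 2 ((Dfn.graph 2 1 hf).and
              (Dfn.pair 0 2 hR)))))).and (Dfn.ex 1 ((Dfn.eqConst 1 (d X)).and (hd 1 0))))).not).congr
        fun a _ _ => and_congr_right fun ha => not_congr ?_)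
    have hsub : sec (a 0) ⊆ X \ Y := fun m hm => hch.sub _ ha m hm
    obtain ⟨hc, -⟩ := hGX _ (hsec (a 0)) hsub
    have hmem : ∀ m, m ∈ G (sec (a 0)) ↔ (m ∈ X ∧ ¬ ![a 0, m] ∈ R) ∨
        ∃ s, (s ∈ X \ Y ∧ m = f s) ∧ ![a 0, s] ∈ R := fun m =>
      or_congr Iff.rfl (exists_congr fun s => ⟨fun h => ⟨⟨hsub h.1, h.2.symm⟩, h.1⟩,
        fun h => ⟨h.2, h.1.2.symm⟩⟩)
    rw [← hdE X _ hX hc]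
    refine ⟨fun h => ⟨_, hc, hmem, _, rfl, h⟩, ?_⟩
    rintro ⟨W, -, hWm, x, rfl, e⟩
    rwa [show W = G (sec (a 0)) from Set.ext fun m => (hWm m).trans (hmem m).symm] at e
  have hall : ∀ x ∈ X \ Y, E X (G (sec x)) := by
    by_contra hne
    push Not at hne
    obtain ⟨x, hx, hxn⟩ := hne
    obtain ⟨u, ⟨⟨-, hun⟩, huD⟩, h | ⟨v, ⟨hv, hvU⟩, hvu, h⟩⟩ :=
      hch.step _ hbad ⟨x, ⟨hx, hxn⟩, hx⟩
    · have e : sec u = insert u ∅ := Set.ext fun m => (h m).trans (by simp)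
      refine hun (e ▸ ?_)
      have := step ∅ u hN.isConcept_empty (Set.empty_subset _) huD (Set.notMem_empty u)
      rwa [hG0] at this
    · have e : sec u = insert u (sec v) := Set.ext h
      have hsub : sec v ⊆ X \ Y := fun m hm => hch.sub v hv m hm
      have hXv : E X (G (sec v)) := by
        by_contra hvn
        exact hvU ⟨hv, hvn⟩
      refine hun (hE.trans X _ _ hX (hGX _ (hsec v) hsub).1
        (hGX _ (hsec u) fun m hm => hch.sub u huD m hm).1 hXv ?_)
      rw [e]
      exact step _ u (hsec v) hsub huD hvu
  by_cases hne : ∃ z, z ∈ X \ Y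
  · obtain ⟨t, ht, htop⟩ := hch.last hne
    have e : G (sec t) = Y := by
      rw [show sec t = X \ Y from Set.ext htop]
      show {z | (z ∈ X ∧ z ∉ X \ Y) ∨ z ∈ f '' (X \ Y)} = Y
      rw [hfb.image_eq]
      ext z
      simp only [Set.mem_ofPred_eq, Set.mem_sdiff]
      tauto
    exact e ▸ hall t ht
  · push Not at hne
    have h0 : X \ Y = ∅ := Set.eq_empty_iff_forall_notMem.2 hne
    have h1 := hfb.image_eq
    rw [h0, Set.image_empty] at h1
    have : X = Y := Set.Subset.antisymm (Set.sdiff_eq_empty.1 h0) (Set.sdiff_eq_empty.1 h1.symm)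
    exact this ▸ hE.refl X hX

open Classical in
/-- If no exchange of one element for another leads to an equivalent concept, `X` and the results
of the exchanges have more abstracts than there are objects, and the objects are infinitely many:
fixing `b ≠ b'` in `X` and `a ≠ a'` outside, an injection of the objects into the abstracts other
than that of `X` sends `m` to the abstract of the result of exchanging `b` for `m` if `m ∉ X`, of
exchanging `m` for `a` if `m ∈ X` and `m ≠ b`, and of exchanging `b'` for `a'` if `m = b`. -/
theorem infinite_of_not_swap
    (hd : N.DfnAbs d) (hdE : ∀ A B, N.IsConcept A → N.IsConcept B → (d A = d B ↔ E A B))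
    (hE : N.IsEquivOnConcepts E) (hP : N.PermInvariant E) (hX : N.IsConcept X) (hT : N.Top X)
    (hs : ∀ A, N.IsConcept A → N.Bicard X A → ∀ b ∈ A, ∀ a ∉ A, ¬ E A (Equiv.swap b a '' A)) :
    N.Infinite Set.univ := by
  obtain ⟨h3, ⟨b, b', hb, hb', hbb⟩, a, a', ha, ha', haa⟩ := hN.exists_distinct_of_top hT
  have hsc : ∀ x y {A}, N.IsConcept A → N.IsConcept (Equiv.swap x y '' A) := fun x y _ hA =>
    hN.isConcept_perm (hN.hasFun_swap x y) hA
  have hsb : ∀ x y, N.Bicard X (Equiv.swap x y '' X) := fun x y =>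
    hN.bicard_perm (hN.hasFun_swap x y) hX
  have ne : ∀ {p q}, p ∈ X → q ∉ X → p ≠ q := fun hp hq h => hq (h ▸ hp)
  have inj : ∀ p q r s, p ∈ X → q ∈ X → r ∉ X → s ∉ X →
      E (Equiv.swap p r '' X) (Equiv.swap q s '' X) → p = q ∧ r = s := by
    intro p q r s hp hq hr hs' h
    have hA := hsc p r hX
    have hB := hsc q s hX
    have key := hs _ hA (hsb p r)
    have eA := swap_image_eq hp hr
    have eB := swap_image_eq hq hs'
    by_contra hne
    by_cases hpq : p = q
    · subst hpq
      have hrs : r ≠ s := fun h => hne ⟨rfl, h⟩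
      refine key r (by simp [eA]) s (by simp [eA, hrs.symm, hs']) ?_
      convert h using 1
      rw [swap_image_eq (by simp [eA]) (by simp [eA, hrs.symm, hs']), eA, eB]
      ext z
      have : z = r → z ∉ X := fun h => h ▸ hr
      simp only [Set.mem_insert_iff, Set.mem_sdiff, Set.mem_singleton_iff]
      tauto
    · by_cases hrs : r = s
      · subst hrs
        have hqA : q ∈ Equiv.swap p r '' X := by simp [eA, hq, Ne.symm hpq]
        have hpA : p ∉ Equiv.swap p r '' X := by simp [eA, ne hp hr]
        refine key q hqA p hpA ?_
        convert h using 1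
        rw [swap_image_eq hqA hpA, eA, eB]
        ext z
        have h1 : z = r → z ≠ q := fun h h' => ne hq hr (h'.symm.trans h)
        have h2 : z = p → z ∈ X := fun h => h ▸ hp
        have h3 : z = p → z ≠ q := fun h h' => hpq (h.symm.trans h')
        simp only [Set.mem_insert_iff, Set.mem_sdiff, Set.mem_singleton_iff]
        tauto
      · -- the transposition of `p` and a third element `c` of `X` fixes the second concept and
        -- acts as an exchange on the first
        obtain ⟨c, hc, hcp, hcq⟩ := h3 p q
        have hcA : c ∈ Equiv.swap p r '' X := by simp [eA, hc, hcp]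
        have hpA : p ∉ Equiv.swap p r '' X := by simp [eA, ne hp hr]
        have hfix : Equiv.swap c p '' (Equiv.swap q s '' X) = Equiv.swap q s '' X :=
          swap_image_eq_self (by simp [eB, hc, hcq, hp, hpq])
        have h' := (hP _ (hN.hasFun_swap c p) _ _ hA hB).1 h
        rw [hfix] at h'
        exact key c hcA p hpA (hE.trans _ _ _ hA hB (hsc c p hA) h
          (hE.symm _ _ (hsc c p hA) hB h'))
  let F : N.carrier → Set N.carrier := fun m => {z |
    (m ∉ X ∧ (z = m ∨ (z ∈ X ∧ z ≠ b))) ∨ (m ∈ X ∧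
      ((m = b ∧ (z = a' ∨ (z ∈ X ∧ z ≠ b'))) ∨ (m ≠ b ∧ (z = a ∨ (z ∈ X ∧ z ≠ m)))))}
  have F₁ : ∀ m, m ∉ X → F m = Equiv.swap b m '' X := fun m hm => by
    rw [swap_image_eq hb hm]; ext z; simp [F, hm]
  have F₂ : F b = Equiv.swap b' a' '' X := by
    rw [swap_image_eq hb' ha']; ext z; simp [F, hb]
  have F₃ : ∀ m, m ∈ X → m ≠ b → F m = Equiv.swap m a '' X := fun m hm hmb => by
    rw [swap_image_eq hm ha]; ext z; simp [F, hm, hmb]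
  have cases : ∀ m, ∃ p r, p ∈ X ∧ r ∉ X ∧ F m = Equiv.swap p r '' X := by
    intro m
    by_cases hm : m ∈ X
    · by_cases hmb : m = b
      · exact ⟨b', a', hb', ha', hmb ▸ F₂⟩
      · exact ⟨m, a, hm, ha, F₃ m hm hmb⟩
    · exact ⟨b, m, hb, hm, F₁ m hm⟩
  have hFc : ∀ m, N.IsConcept (F m) := fun m => by
    obtain ⟨p, r, -, -, e⟩ := cases m
    exact e ▸ hsc p r hX
  have hg : N.HasFun (fun m => d (F m)) Set.univ := by
    refine hN.hasFun ((Dfn.exConcept 0 (Q := fun s _ W => (∀ z, z ∈ W ↔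
      (s 0 ∉ X ∧ (z = s 0 ∨ (z ∈ X ∧ z ≠ b))) ∨ (s 0 ∈ X ∧
      ((s 0 = b ∧ (z = a' ∨ (z ∈ X ∧ z ≠ b'))) ∨
        (s 0 ≠ b ∧ (z = a ∨ (z ∈ X ∧ z ≠ s 0)))))) ∧ s 1 = d W)
      (Dfn.and (Dfn.all 2 ((Dfn.memVar 2 0).iff (Dfn.or ?_ ?_))) (hd 1 0))).congr
        fun s _ _ => ?_)
    · exact (Dfn.mem 0 hX).not.and ((Dfn.eq 2 0).or ((Dfn.mem 2 hX).and (Dfn.eqConst 2 b).not))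
    · exact (Dfn.mem 0 hX).and (((Dfn.eqConst 0 b).and ((Dfn.eqConst 2 a').or
        ((Dfn.mem 2 hX).and (Dfn.eqConst 2 b').not))).or ((Dfn.eqConst 0 b).not.and
        ((Dfn.eqConst 2 a).or ((Dfn.mem 2 hX).and (Dfn.eq 2 0).not))))
    · refine ⟨fun h => ⟨F (s 0), hFc _, fun z => Iff.rfl, h.2⟩, ?_⟩
      rintro ⟨W, -, hWF, e⟩
      exact ⟨trivial, by rw [e, show W = F (s 0) from Set.ext hWF]⟩
  refine ⟨{d X}ᶜ, hN.isConcept_compl (hN.isConcept_singleton _),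
    ⟨Set.subset_univ _, fun h => h (Set.mem_univ (d X)) rfl⟩, _, hg, fun m _ hm => ?_,
    fun m _ m' _ e => ?_⟩
  · obtain ⟨p, r, hp, hr, e⟩ := cases m
    have h' : E X (F m) := (hdE X _ hX (hFc m)).1 (Eq.symm hm)
    rw [e] at h'
    exact hs X hX ⟨hN.cardEq_refl hX, hN.cardEq_refl (hN.isConcept_compl hX)⟩ p hp r hr h'
  · have h : E (F m) (F m') := (hdE _ _ (hFc m) (hFc m')).1 e
    by_cases hm : m ∈ X <;> by_cases hm' : m' ∈ X
    · by_cases hmb : m = b <;> by_cases hmb' : m' = b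
      · exact hmb.trans hmb'.symm
      · subst hmb
        rw [F₂, F₃ m' hm' hmb'] at h
        exact absurd (inj _ _ _ _ hb' hm' ha' ha h).2.symm haa
      · subst hmb'
        rw [F₂, F₃ m hm hmb] at h
        exact absurd (inj _ _ _ _ hm hb' ha ha' h).2 haa
      · rw [F₃ m hm hmb, F₃ m' hm' hmb'] at h
        exact (inj _ _ _ _ hm hm' ha ha h).1
    · by_cases hmb : m = b
      · subst hmb
        rw [F₂, F₁ m' hm'] at h
        exact absurd (inj _ _ _ _ hb' hb ha' hm' h).1.symm hbb
      · rw [F₃ m hm hmb, F₁ m' hm'] at h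
        exact absurd (inj _ _ _ _ hm hb ha hm' h).1 hmb
    · by_cases hmb' : m' = b
      · subst hmb'
        rw [F₂, F₁ m hm] at h
        exact absurd (inj _ _ _ _ hb hb' hm ha' h).1 hbb
      · rw [F₃ m' hm' hmb', F₁ m hm] at h
        exact absurd (inj _ _ _ _ hb hm' hm ha h).1.symm hmb'
    · rw [F₁ m hm, F₁ m' hm'] at h
      exact (inj _ _ _ _ hb hb hm hm' h).2

open Classical in
theorem rel_of_finite (hW : N.toFrame.WellBehaved) (hu : ¬ N.Infinite Set.univ)
    (hd : N.DfnAbs d) (hdE : ∀ A B, N.IsConcept A → N.IsConcept B → (d A = d B ↔ E A B))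
    (hE : N.IsEquivOnConcepts E) (hP : N.PermInvariant E) (hX : N.IsConcept X) (hT : N.Top X)
    (hY : N.IsConcept Y) (hXY : N.Bicard X Y) : E X Y := by
  by_cases h : ∃ A, N.IsConcept A ∧ N.Bicard X A ∧ ∃ b ∈ A, ∃ a ∉ A, E A (Equiv.swap b a '' A)
  · obtain ⟨A, hA, hXA, b, hb, a, ha, hAb⟩ := h
    exact hN.rel_of_swap hW hu hd hdE hE hX hY hXY fun B hB hXB b' hb' a' ha' =>
      hN.rel_swap hP hA (hN.bicard_trans (hN.bicard_symm hXA) hXB) hb ha hb' ha' hAb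
  · push Not at h
    exact absurd (hN.infinite_of_not_swap hd hdE hE hP hX hT h) hu

/-! ### Models of abstraction principles -/

/-- A definable abstraction operator for a permutation invariant equivalence relation `E` identifies
bicardinally equivalent TOP concepts. -/
theorem rel_of_top (hW : N.toFrame.WellBehaved)
    (hd : N.DfnAbs d) (hdE : ∀ A B, N.IsConcept A → N.IsConcept B → (d A = d B ↔ E A B))
    (hE : N.IsEquivOnConcepts E) (hP : N.PermInvariant E) (hX : N.IsConcept X) (hT : N.Top X)
    (hY : N.IsConcept Y) (hXY : N.Bicard X Y) : E X Y := by
  by_cases hu : N.Infinite Set.univ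
  swap
  · exact hN.rel_of_finite hW hu hd hdE hE hP hX hT hY hXY
  have hXc := hN.isConcept_compl hX
  have hYc := hN.isConcept_compl hY
  rcases hW.comparability X Xᶜ hX hXc with hle | hle
  · exact hN.rel_of_infinite hW hu hd hdE hE hP hX hT hle hY hXY
  · -- pass to the relation between the complements
    have hd' : N.DfnAbs (fun A => d Aᶜ) := by
      intro i k
      refine (Dfn.exConcept (k + 1) (Q := fun a A W =>
        (∀ m, m ∈ W ↔ ¬ m ∈ Frame.ofRel (A 0 k)) ∧ a i = d W)
        ((Dfn.all (i + 1) ((Dfn.memVar (i + 1) (k + 1)).iff (Dfn.memVar (i + 1) k).not)).and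
          (hd i (k + 1)))).congr fun a A hA => ⟨fun h => ?_, ?_⟩
      · exact ⟨_, hN.isConcept_compl (Frame.isConcept_ofRel (hA 0 k)), fun m => Iff.rfl, h⟩
      · rintro ⟨W, -, hW', e⟩
        rwa [show W = (Frame.ofRel (A 0 k))ᶜ from Set.ext hW'] at e
    have hE' : N.IsEquivOnConcepts (fun A B => E Aᶜ Bᶜ) :=
      ⟨fun A hA => hE.refl _ (hN.isConcept_compl hA),
        fun A B hA hB => hE.symm _ _ (hN.isConcept_compl hA) (hN.isConcept_compl hB),
        fun A B C hA hB hC => hE.trans _ _ _ (hN.isConcept_compl hA) (hN.isConcept_compl hB)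
          (hN.isConcept_compl hC)⟩
    have hP' : N.PermInvariant (fun A B => E Aᶜ Bᶜ) := fun π hπ A B hA hB => by
      show E Aᶜ Bᶜ ↔ E (π '' A)ᶜ (π '' B)ᶜ
      rw [← Set.image_compl_eq π.bijective, ← Set.image_compl_eq π.bijective]
      exact hP π hπ _ _ (hN.isConcept_compl hA) (hN.isConcept_compl hB)
    have := hN.rel_of_infinite (E := fun A B => E Aᶜ Bᶜ) hW hu hd'
      (fun A B hA hB => hdE _ _ (hN.isConcept_compl hA) (hN.isConcept_compl hB)) hE' hP' hXc
      ⟨hT.2, (compl_compl X).symm ▸ hT.1⟩ ((compl_compl X).symm ▸ hle) hYc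
      ⟨hXY.2, by rw [compl_compl, compl_compl]; exact hXY.1⟩
    rwa [compl_compl, compl_compl] at this

end Structure.Comprehension

theorem Structure.dfnAbs_expand {L : Signature.{v}} (N : Structure.{u, v} L)
    (d : Set N.carrier → N.carrier) : (N.expand d).DfnAbs d := by
  intro i k
  obtain ⟨B, hB⟩ := (N.expand d).exists_admissible
  refine ⟨.symb (L := L.withAbs) none (fun _ => 2 * i) (fun _ => 2 * k), fun _ =>
    (N.expand d).nonempty.some, B, hB, fun a A _ => ?_⟩
  have h₁ := interleave_even a (fun _ => (N.expand d).nonempty.some) i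
  have h₂ := interleave_even (A 0) (B 0) k
  exact iff_of_eq (congrArg₂ (fun x S => x = d (Frame.ofRel S)) h₁ h₂)

/-- `E₀` is finer than `E` in the models of `A_E`. -/
theorem Structure.rel_of_basal {L : Signature.{v}} {N : Structure.{u, v} L}
    {E : Set N.carrier → Set N.carrier → Prop} {d : Set N.carrier → N.carrier}
    (hm : N.ModelsAbstraction d E) (hE : N.IsEquivOnConcepts E) (hP : N.PermInvariant E)
    {X Y : Set N.carrier} (hX : N.IsConcept X) (hY : N.IsConcept Y) (h : N.Basal X Y) : E X Y := by
  rcases h with ⟨hT, -, hXY⟩ | ⟨-, rfl⟩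
  · exact Comprehension.rel_of_top (N := N.expand d) hm.1.1 hm.1.2 (N.dfnAbs_expand d) hm.2 hE hP
      hX hT hY hXY
  · exact hE.refl X hX

/-! ### The full structure over the natural numbers -/

/-- The structure on `ℕ` whose relations of each arity are all the relations. -/
def fullNat : Structure.{0, 0} Signature.pure :=
  Frame.toPure ⟨ℕ, ⟨0⟩, fun _ => Set.univ, fun _ => ⟨∅, trivial⟩⟩

namespace fullNat

theorem isConcept (X : Set ℕ) : fullNat.IsConcept X := trivial

theorem hasFun (f : ℕ → ℕ) (X : Set ℕ) : fullNat.HasFun f X := trivial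

/-- Every map between sets of natural numbers extends to all natural numbers. -/
theorem exists_extend {α : Type*} {X : Set α} (f : X → ℕ) :
    ∃ g : α → ℕ, ∀ x (hx : x ∈ X), g x = f ⟨x, hx⟩ := by
  classical
  exact ⟨fun x => if hx : x ∈ X then f ⟨x, hx⟩ else 0, fun x hx => dif_pos hx⟩

theorem cardLe_of_mk_le {X Y : Set ℕ} (h : Cardinal.mk X ≤ Cardinal.mk Y) :
    fullNat.CardLe X Y := by
  obtain ⟨f⟩ := h
  obtain ⟨g, hg⟩ := exists_extend (fun x => (f x : ℕ))
  refine ⟨g, hasFun g X, fun x hx => ?_, fun x hx y hy e => ?_⟩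
  · rw [hg x hx]; exact (f _).2
  · rw [hg x hx, hg y hy] at e
    exact congrArg Subtype.val (f.injective (Subtype.ext e))

theorem bijOn_of_equiv {α : Type*} {X : Set α} {Y : Set ℕ} (f : X ≃ Y) :
    ∃ g : α → ℕ, Set.BijOn g X Y := by
  obtain ⟨g, hg⟩ := exists_extend (fun x => (f x : ℕ))
  refine ⟨g, fun x hx => ?_, fun x hx y hy e => ?_, fun y hy => ?_⟩
  · rw [hg x hx]; exact (f _).2
  · rw [hg x hx, hg y hy] at e
    exact congrArg Subtype.val (f.injective (Subtype.ext e))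
  · exact ⟨f.symm ⟨y, hy⟩, (f.symm ⟨y, hy⟩).2, by rw [hg _ (f.symm ⟨y, hy⟩).2]; simp⟩

/-- Countably infinite sets are in bijection. -/
theorem exists_bijOn {α : Type*} [Countable α] {X : Set α} {Y : Set ℕ} (hX : X.Infinite)
    (hY : Y.Infinite) : ∃ g : α → ℕ, Set.BijOn g X Y := by
  have := hX.to_subtype
  have := hY.to_subtype
  obtain ⟨e⟩ := nonempty_equiv_of_countable (α := X) (β := Y)
  exact bijOn_of_equiv e

theorem infinite_of_infinite {X : Set ℕ} (h : fullNat.Infinite X) : X.Infinite := by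
  obtain ⟨Z, -, hss, f, -, hm, hi⟩ := h
  intro hfin
  exact absurd (Set.ncard_le_ncard_of_injOn f hm hi (hfin.subset hss.subset))
    (not_le.2 (Set.ncard_lt_ncard hss hfin))

theorem sumEq {X Y Z : Set ℕ} (hX : X.Infinite) (hZ : Z.Infinite) : fullNat.SumEq X Y Z := by
  have := hX.to_subtype
  have := hZ.to_subtype
  obtain ⟨e⟩ := nonempty_equiv_of_countable (α := X ⊕ Y) (β := Z)
  obtain ⟨f, hf⟩ := exists_extend (fun x => (e (Sum.inl x) : ℕ))
  obtain ⟨g, hg⟩ := exists_extend (fun y => (e (Sum.inr y) : ℕ))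
  refine ⟨f, g, hasFun f X, hasFun g Y, fun x hx y hy h => ?_, fun x hx y hy h => ?_, ?_, ?_⟩
  · rw [hf x hx, hf y hy] at h
    exact congrArg Subtype.val (Sum.inl_injective (e.injective (Subtype.ext h)))
  · rw [hg x hx, hg y hy] at h
    exact congrArg Subtype.val (Sum.inr_injective (e.injective (Subtype.ext h)))
  · rw [Set.disjoint_left]
    rintro _ ⟨x, hx, rfl⟩ ⟨y, hy, h⟩
    rw [hf x hx, hg y hy] at h
    exact Sum.inr_ne_inl (e.injective (Subtype.ext h))
  · ext z
    constructor
    · rintro (⟨x, hx, rfl⟩ | ⟨y, hy, rfl⟩)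
      · rw [hf x hx]; exact (e _).2
      · rw [hg y hy]; exact (e _).2
    · intro hz
      rcases h : e.symm ⟨z, hz⟩ with ⟨x, hx⟩ | ⟨y, hy⟩
      · exact Or.inl ⟨x, hx, by rw [hf x hx, ← h]; simp⟩
      · exact Or.inr ⟨y, hy, by rw [hg y hy, ← h]; simp⟩

theorem prodEq {X Y Z : Set ℕ} (hX : X.Infinite) (hY : Y.Infinite) (hZ : Z.Infinite) :
    fullNat.ProdEq X Y Z := by
  obtain ⟨h, hb⟩ := exists_bijOn (X := X ×ˢ Y) (hX.prod_left hY.nonempty) hZ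
  exact ⟨h, trivial, hb⟩

theorem wellBehaved : fullNat.toFrame.WellBehaved where
  comparability X Y _ _ :=
    (le_total (Cardinal.mk X) (Cardinal.mk Y)).imp cardLe_of_mk_le cardLe_of_mk_le
  sums X Y _ _ hX hY := ⟨fun _ => sumEq (infinite_of_infinite hX) (infinite_of_infinite hY),
    fun _ => sumEq (infinite_of_infinite hX) (infinite_of_infinite hX)⟩
  products X Y _ _ hX hY := by
    have hX' := infinite_of_infinite hX
    have hY' := infinite_of_infinite hY
    exact ⟨fun _ => prodEq hX' hY' hY', fun _ => prodEq hX' hY' hX'⟩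
  wellFounded Φ a A _ := by
    rintro ⟨X, -, hX⟩
    obtain ⟨Z, hZ, hmin⟩ := (InvImage.wf (fun Y : Set ℕ => Cardinal.mk Y)
      Cardinal.lt_wf).has_min {Y | fullNat.SatAt Φ a A Y} ⟨X, hX⟩
    exact ⟨Z, isConcept Z, hZ, fun Y _ hY => cardLe_of_mk_le (not_lt.1 (hmin Y hY))⟩

/-- In the full structure a set is exponentially large just in case it is infinite: there are only
countably many finite sets, whereas diagonalization applies to the subsets of an infinite set. -/
theorem expl_iff {X : Set ℕ} : fullNat.Expl X ↔ X.Infinite := by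
  rw [← not_iff_not, Set.not_infinite]
  refine Frame.not_expl_iff.trans ⟨?_, fun hX => ?_⟩
  · rintro ⟨R, -, hR⟩
    by_contra hX
    obtain ⟨e⟩ : Nonempty (ℕ ↪ X) := by
      have := Set.infinite_coe_iff.2 hX
      exact ⟨_root_.Infinite.natEmbedding X⟩
    obtain ⟨n, hn⟩ := hR {x | ∃ n, x = (e n : ℕ) ∧ ![n, x] ∉ R} (isConcept _) (by
      rintro _ ⟨n, rfl, -⟩; exact (e n).2)
    have key : ![n, (e n : ℕ)] ∈ R ↔ ∃ m, (e n : ℕ) = (e m : ℕ) ∧ ![m, (e n : ℕ)] ∉ R :=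
      Set.ext_iff.1 hn (e n : ℕ)
    have h2 : (∃ m, (e n : ℕ) = (e m : ℕ) ∧ ![m, (e n : ℕ)] ∉ R) ↔ ![n, (e n : ℕ)] ∉ R := by
      refine ⟨?_, fun h => ⟨n, rfl, h⟩⟩
      rintro ⟨m, h, hm⟩
      obtain rfl : n = m := e.injective (Subtype.ext h)
      exact hm
    exact iff_not_self (key.trans h2)
  · refine ⟨{y : Fin 2 → ℕ | y 1 ∈ Denumerable.ofNat (Finset ℕ) (y 0)}, trivial,
      fun U _ hU => ?_⟩
    obtain ⟨n, hn⟩ : ∃ n, Denumerable.ofNat (Finset ℕ) n = (hX.subset hU).toFinset :=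
      ⟨_, Denumerable.ofNat_encode _⟩
    have key : ∀ z : ℕ, z ∈ Denumerable.ofNat (Finset ℕ) n ↔ z ∈ U := fun z => by
      rw [hn]; exact (hX.subset hU).mem_toFinset
    exact ⟨n, Set.ext key⟩

theorem top_iff {X : Set ℕ} : fullNat.Top X ↔ X.Infinite ∧ Xᶜ.Infinite :=
  and_congr expl_iff expl_iff

theorem bicard_of_top {X Y : Set ℕ} (hX : fullNat.Top X) (hY : fullNat.Top Y) :
    fullNat.Bicard X Y := by
  rw [top_iff] at hX hY
  obtain ⟨f, hf⟩ := exists_bijOn hX.1 hY.1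
  obtain ⟨g, hg⟩ := exists_bijOn hX.2 hY.2
  exact ⟨⟨f, hasFun f X, hf⟩, g, hasFun g Xᶜ, hg⟩

/-- Only the finite and the cofinite sets fail to be TOP. -/
theorem countable_not_top : {X : Set ℕ | ¬ fullNat.Top X}.Countable := by
  have hfin : {X : Set ℕ | X.Finite}.Countable := Set.Countable.ofPred_finite
  refine (hfin.union (hfin.image compl)).mono fun X hX => ?_
  have hX' : ¬ fullNat.Top X := hX
  rw [top_iff, not_and_or, Set.not_infinite, Set.not_infinite] at hX'
  rcases hX' with h | h
  · exact Or.inl h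
  · exact Or.inr ⟨Xᶜ, h, compl_compl X⟩

/-- If all but countably many elements form one class and the others are singleton classes, the
classes can be numbered. -/
theorem exists_abstraction {α : Type*} {T : α → Prop} (hT : {x | ¬ T x}.Countable) :
    ∃ d : α → ℕ, ∀ x y, d x = d y ↔ (T x ∧ T y) ∨ (¬ (T x ∨ T y) ∧ x = y) := by
  classical
  have := hT.to_subtype
  obtain ⟨c, hc⟩ := exists_injective_nat {x | ¬ T x}
  refine ⟨fun x => if h : T x then 0 else c ⟨x, h⟩ + 1, fun x y => ?_⟩
  by_cases hx : T x <;> by_cases hy : T y <;> simp [hx, hy, hc.eq_iff]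

/-- The full structure over the natural numbers expands to a model of `A_{E₀}`: all TOP concepts are
bicardinally equivalent, and only countably many concepts are not TOP. -/
theorem exists_modelsAbstraction :
    ∃ d : Set ℕ → ℕ, fullNat.ModelsAbstraction d fullNat.Basal := by
  obtain ⟨d, hd⟩ := exists_abstraction countable_not_top
  refine ⟨d, ⟨fun _ _ _ _ _ => trivial, wellBehaved⟩, fun X Y _ _ => (hd X Y).trans ?_⟩
  exact or_congr_left (and_congr_right fun hX =>
    ⟨fun hY => ⟨hY, bicard_of_top hX hY⟩, fun h => h.1⟩)

end fullNat

end SOL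

theorem mainTheorem5 :
    -- the theory `A_{E₀}` is consistent
    (∃ (N : SOL.Structure.{0, 0} SOL.Signature.pure) (d : Set N.carrier → N.carrier),
      N.ModelsAbstraction d N.Basal) ∧
    -- `E₀` is finer than `E` in all models of `A_E`, for any expressible permutation invariant `E`
    (∀ (L : SOL.Signature.{v}) (φ : SOL.Formula L),
      (∀ N : SOL.Structure.{u, v} L, N.IsBackgroundModel →
        N.IsEquivOnConcepts (N.Rel2 φ) ∧ N.PermInvariant (N.Rel2 φ)) →
      ∀ (N : SOL.Structure.{u, v} L) (d : Set N.carrier → N.carrier),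
        N.ModelsAbstraction d (N.Rel2 φ) →
        ∀ X Y, N.IsConcept X → N.IsConcept Y → N.Basal X Y → N.Rel2 φ X Y) := by
  refine ⟨⟨SOL.fullNat, SOL.fullNat.exists_modelsAbstraction⟩,
    fun L φ hφ N d hm X Y hX hY h => ?_⟩
  obtain ⟨hE, hP⟩ := hφ N (N.isBackgroundModel_of_expand d hm.1)
  exact SOL.Structure.rel_of_basal hm hE hP hX hY h
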